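/- Let $0<\omega\le\pi/2$. An \emph{$\omega$-wedge} consists of an apex $q$ and two rays (arms) $H_1,H_2$ from $q$ forming the angle $\omega$, such that $(q,H_1,H_2)$ is a left turn, together with all points between them. A \emph{valid $\omega$-probe} of a convex polygon $\mathcal O$ along a directed line $\overrightarrow L$ is an $\omega$-wedge with apex $q\in \overrightarrow L$ that contains $\mathcal O$ and each of whose arms meets $\mathcal O$, such that the ray from $q$ in the direction of $\overrightarrow L$ meets $\mathcal O$. Its outcome $(q,H_1,H_2,p_1,p_2)$ also records the points $p_1$, $p_2$ of $\mathcal O\cap H_1$, $\mathcal O\cap H_2$ closest to $q$. Let $\mathcal O$ be an unknown (closed) convex $n$-gon, $n\ge 3$, with $n$ unknown too, all of whose internal angles are strictly larger than $\omega$. We are given a point $p\in\mathcal O$ and a disk $\Psi\supseteq\mathcal O$. To probe along $\overrightarrow L$, the wedge is initially placed with its apex on $\overrightarrow L$ so that it contains $\Psi$ and the ray from its apex in the direction of $\overrightarrow L$; then its apex moves along $\overrightarrow L$, in the direction of $\overrightarrow L$, to that of a valid $\omega$-probe of $\mathcal O$ along $\overrightarrow L$. Consider the following algorithm. It maintains a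 convex polygon $Q$ (at first with only two vertices, each being the counter-clockwise successor of the other), a Boolean $\mathit{flag}(u)$ for each vertex $u$ of $Q$, and an integer $F$. Initialization: probe along an arbitrary directed line through $p$, with outcome $(q,H_1,H_2,p_1,p_2)$; let $Q$ have the vertices $p_1,p_2$, set both flags to false, and set $F=2$. While $F\ne 0$: take an arbitrary vertex $u$ of $Q$ with $\mathit{flag}(u)$ false, let $v$ be its counter-clockwise successor in $Q$, and probe along the line through $u$ and $v$, directed from $u$ to $v$, with outcome $(q,H_1,H_2,p_1,p_2)$. (1) If $p_1\neq u$ and $p_2\ne u$: insert $p_1$ into $Q$ between $u$ and $v$, set $\mathit{flag}(p_1)$ to false and $F=F+1$; then, if $p_2$ is not a vertex of $Q$, replace $Q$ by the convex hull of $Q\cup\{p_2\}$, set $\mathit{flag}(p_2)$ to false and $F=F+1$. (2) If $p_1=u$: set $\mathit{flag}(u)$ to true and $F=F-1$; then, if $p_2$ is not a vertex of $Q$, replace $Q$ by the convex hull of $Q\cup\{p_2\}$, set $\mathit{flag}(p_2)$ to false and $F=F+1$. (3) If $p_2=u\neq p_1$: set $\mathit{flag}(v)$ to true, insert $p_1$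 into $Q$ between $u$ and $v$, and set $\mathit{flag}(p_1)$ to false. Then, for all choices made in the course of the algorithm (the first line, the vertex $u$ in each iteration, the initial placements of the wedge), every step of the algorithm can be carried out, the algorithm terminates after at most $2n-2$ $\omega$-probes in total (including the one of the initialization), and when it terminates $Q=\mathcal O$: the vertices of $Q$ are exactly the vertices of $\mathcal O$, in the same counter-clockwise order. -/

import Mathlib

namespace WedgeProbe

noncomputable section

/-- The Euclidean plane. -/
abbrev Plane : Type := EuclideanSpace ℝ (Fin 2)

/-- The signed area of the parallelogram spanned by `a` and `b`; positive iff `b` points strictly to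
the left of `a`. -/
def cross (a b : Plane) : ℝ := a 0 * b 1 - a 1 * b 0

/-- The closed ray emanating from `q` in direction `d`. -/
def ray (q d : Plane) : Set Plane := {x | ∃ t : ℝ, 0 ≤ t ∧ x = q + t • d}

/-! ### Convex polygons -/

/-- `v 0, …, v (n - 1)` are the vertices, in counter-clockwise order, of a convex `n`-gon
(every three vertices taken in this order form a strict left turn). -/
def IsConvexPolygon {n : ℕ} (v : Fin n → Plane) : Prop :=
  3 ≤ n ∧ ∀ i j k : Fin n, i < j → j < k → 0 < cross (v j - v i) (v k - v i)

/-- The closed region bounded by the convex polygon with vertices `v`. -/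
def polygon {n : ℕ} (v : Fin n → Plane) : Set Plane := convexHull ℝ (Set.range v)

/-- The internal angle of the convex polygon at the vertex `v i`
(`finRotate n` is the cyclic successor on `Fin n`). -/
def internalAngle {n : ℕ} (v : Fin n → Plane) (i : Fin n) : ℝ :=
  EuclideanGeometry.angle (v ((finRotate n).symm i)) (v i) (v (finRotate n i))

/-! ### Wedges and probes -/

/-- An apex together with the directions of the two arms `H₁`, `H₂`. -/
structure Wedge where
  apex : Plane
  dir₁ : Plane
  dir₂ : Plane

namespace Wedge

/-- The arm `H₁`. -/
def arm₁ (W : Wedge) : Set Plane := ray W.apex W.dir₁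

/-- The arm `H₂`. -/
def arm₂ (W : Wedge) : Set Plane := ray W.apex W.dir₂

/-- The closed set formed by the apex, the two arms and the points between them. -/
def region (W : Wedge) : Set Plane :=
  {x | ∃ s t : ℝ, 0 ≤ s ∧ 0 ≤ t ∧ x = W.apex + s • W.dir₁ + t • W.dir₂}

/-- `W` is an `ω`-wedge: the arms (given by unit vectors) form the angle `ω`, and
`(apex, H₁, H₂)` is a left turn. -/
def IsOmegaWedge (ω : ℝ) (W : Wedge) : Prop :=
  ‖W.dir₁‖ = 1 ∧ ‖W.dir₂‖ = 1 ∧ InnerProductGeometry.angle W.dir₁ W.dir₂ = ω ∧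
    0 < cross W.dir₁ W.dir₂

/-- `W` is a valid `ω`-probe of `O`: an `ω`-wedge that contains `O` and each of whose arms
contains a point of `O`. -/
def IsValidProbe (ω : ℝ) (O : Set Plane) (W : Wedge) : Prop :=
  W.IsOmegaWedge ω ∧ O ⊆ W.region ∧ (O ∩ W.arm₁).Nonempty ∧ (O ∩ W.arm₂).Nonempty

end Wedge

/-- A directed line, given by one of its points and a nonzero direction. -/
structure DirectedLine where
  point : Plane
  dir : Plane
  dir_ne_zero : dir ≠ 0

namespace DirectedLine

/-- The points of a directed line. -/
def points (L : DirectedLine) : Set Plane := {x | ∃ t : ℝ, x = L.point + t • L.dir}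

/-- The line through `u` and `v`, directed from `u` to `v`. -/
def through (u v : Plane) (h : u ≠ v) : DirectedLine := ⟨u, v - u, sub_ne_zero.mpr h.symm⟩

end DirectedLine

/-- `W` is a valid `ω`-probe of `O` with respect to the directed line `L`. -/
def IsValidProbeAlong (ω : ℝ) (O : Set Plane) (L : DirectedLine) (W : Wedge) : Prop :=
  W.IsValidProbe ω O ∧ W.apex ∈ L.points ∧ (ray W.apex L.dir ∩ O).Nonempty

/-- An admissible initial placement of the probing tool for a probe along `L`: an `ω`-wedge with
apex on `L` which encloses the known disk `Ψ` and the positive direction of `L`. -/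
def IsInitialPlacement (ω : ℝ) (Ψ : Set Plane) (L : DirectedLine) (W₀ : Wedge) : Prop :=
  W₀.IsOmegaWedge ω ∧ W₀.apex ∈ L.points ∧ Ψ ⊆ W₀.region ∧ ray W₀.apex L.dir ⊆ W₀.region

/-- The data returned by a probe: the apex, the directions of both arms, and two contact points. -/
structure Outcome where
  wedge : Wedge
  p₁ : Plane
  p₂ : Plane

/-- `x` is a point of `A` closest to `q`. -/
def IsClosest (q : Plane) (A : Set Plane) (x : Plane) : Prop :=
  x ∈ A ∧ ∀ y ∈ A, dist q x ≤ dist q y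

/-- `o` is an outcome of probing `O` along `L` from the initial placement `W₀`: the apex has moved
from the apex of `W₀` in the direction of `L` to a valid `ω`-probe of `O` with respect to `L`, and
`p₁`, `p₂` are the points of `O` on the arms `H₁`, `H₂` that are closest to the apex. -/
def IsOutcome (ω : ℝ) (O : Set Plane) (L : DirectedLine) (W₀ : Wedge) (o : Outcome) : Prop :=
  IsValidProbeAlong ω O L o.wedge ∧ o.wedge.apex ∈ ray W₀.apex L.dir ∧
    IsClosest o.wedge.apex (O ∩ o.wedge.arm₁) o.p₁ ∧
    IsClosest o.wedge.apex (O ∩ o.wedge.arm₂) o.p₂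

/-- The probe along `L` can be carried out: the tool can be initially placed so that it encloses
`Ψ`, and from every such placement the probe has an outcome. -/
def CanProbe (ω : ℝ) (O Ψ : Set Plane) (L : DirectedLine) : Prop :=
  (∃ W₀, IsInitialPlacement ω Ψ L W₀) ∧
    ∀ W₀, IsInitialPlacement ω Ψ L W₀ → ∃ o, IsOutcome ω O L W₀ o

/-! ### The algorithm

The operations below only see the stored data and the outcomes of the probes; neither the unknown
polygon nor its number of vertices is available to them. -/

/-- The data kept by the algorithm: the vertices of the current convex polygon `Q` (possibly only
two), for each vertex its counter-clockwise successor in `Q` and its flag, and the variable `F`.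
The values of `next` and `flag` outside `verts` are irrelevant. -/
structure State where
  verts : Finset Plane
  next : Plane → Plane
  flag : Plane → Bool
  F : ℤ

/-- `b` is the counter-clockwise successor of `a` in the convex polygon with vertex set `V`
(for `V = {a, b}` each of the two points is the successor of the other one). -/
def IsCcwSucc (V : Finset Plane) (a b : Plane) : Prop :=
  a ∈ V ∧ b ∈ V ∧ a ≠ b ∧ ∀ w ∈ V, w ≠ a → w ≠ b → 0 < cross (b - a) (w - a)

open Classical in
/-- The counter-clockwise successor of `a` in the convex polygon with vertex set `V`
(and `a` itself if there is none). -/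
def ccwSucc (V : Finset Plane) (a : Plane) : Plane :=
  if h : ∃ b, IsCcwSucc V a b then h.choose else a

open Classical in
/-- The vertices of the convex hull of a finite set. -/
def hullVertices (V : Finset Plane) : Finset Plane :=
  V.filter fun x => x ∈ (convexHull ℝ (V : Set Plane)).extremePoints ℝ

namespace State

/-- The polygon `Q`. -/
def polygon (S : State) : Set Plane := convexHull ℝ (S.verts : Set Plane)

open Classical in
/-- Insert `x` into `Q` between `u` and `v`, and set `flag x = false`. -/
def insertBetween (S : State) (u v x : Plane) : State where
  verts := insert x S.verts
  next := Function.update (Function.update S.next u x) x v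
  flag := Function.update S.flag x false
  F := S.F

open Classical in
/-- Replace `Q` by the convex hull of `Q ∪ {x}`, and set `flag x = false`. -/
def insertHull (S : State) (x : Plane) : State where
  verts := hullVertices (insert x S.verts)
  next := ccwSucc (hullVertices (insert x S.verts))
  flag := Function.update S.flag x false
  F := S.F

open Classical in
/-- Set `flag u = true`. -/
def setFlag (S : State) (u : Plane) : State :=
  { S with flag := Function.update S.flag u true }

/-- Set `F = F + k`. -/
def addF (S : State) (k : ℤ) : State := { S with F := S.F + k }

open Classical in
/-- If `x` is not a vertex of `Q`, replace `Q` by the convex hull of `Q ∪ {x}`, set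
`flag x = false` and `F = F + 1`. -/
def addIfNew (S : State) (x : Plane) : State :=
  if x ∈ S.verts then S else (S.insertHull x).addF 1

end State

open Classical in
/-- The state after the first probe. -/
def firstState (o : Outcome) : State where
  verts := {o.p₁, o.p₂}
  next := fun x => if x = o.p₁ then o.p₂ else o.p₁
  flag := fun _ => false
  F := 2

open Classical in
/-- The update performed in one iteration of the loop, when `u` is the chosen vertex and `o` is the
outcome of the probe along the line directed from `u` to its successor `v`. -/
def State.update (S : State) (u : Plane) (o : Outcome) : State :=
  let v := S.next u
  if o.p₁ = u then
    ((S.setFlag u).addF (-1)).addIfNew o.p₂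
  else if o.p₂ = u then
    (S.setFlag v).insertBetween u v o.p₁
  else
    ((S.insertBetween u v o.p₁).addF 1).addIfNew o.p₂

/-- `Run ω O p Ψ k S`: with the unknown polygon `O`, the known point `p` and the known disk `Ψ`,
some execution of the algorithm is in state `S` after exactly `k` probes. The first line through
`p`, the vertex `u` in each iteration and all initial placements of the tool are arbitrary. -/
inductive Run (ω : ℝ) (O : Set Plane) (p : Plane) (Ψ : Set Plane) : ℕ → State → Prop
  | first (L : DirectedLine) (hL : p ∈ L.points) (W₀ : Wedge) (hW₀ : IsInitialPlacement ω Ψ L W₀)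
      (o : Outcome) (ho : IsOutcome ω O L W₀ o) : Run ω O p Ψ 1 (firstState o)
  | iterate {k : ℕ} {S : State} (hS : Run ω O p Ψ k S) (hF : S.F ≠ 0)
      (u : Plane) (hu : u ∈ S.verts) (hflag : S.flag u = false) (hne : u ≠ S.next u)
      (W₀ : Wedge) (hW₀ : IsInitialPlacement ω Ψ (DirectedLine.through u (S.next u) hne) W₀)
      (o : Outcome) (ho : IsOutcome ω O (DirectedLine.through u (S.next u) hne) W₀ o) :
      Run ω O p Ψ (k + 1) (S.update u o)

end

end WedgeProbe

open WedgeProbe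

/-!
Write `O` for the unknown polygon. Because `ω ≤ π / 2`, two points of an `ω`-wedge are seen from its
apex under an angle of at most `ω` (`angle_le_of_mem_cone`). As every internal angle of `O` exceeds
`ω`, the apex of an `ω`-wedge around `O` is never a point of `O` (`apex_notMem_polygon`).

*Probes exist.* The pairs (apex on the line between the initial apex and `O`, direction of the first
arm) whose `ω`-wedge contains `O` form a compact set. Take one whose apex is furthest along the line.
If one of its arms missed `O`, a small rotation would make both arms miss `O`, and then the apex could
still be moved forward (`exists_isValidProbe`).

*What a probe reveals.* An arm lies on a supporting line, so its contact point is a vertex. For a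
probe along the line from the vertex `u` to the vertex `v`, the apex lies behind `u`. Hence the right
contact is `u` exactly if `uv` is an edge of `O`, and otherwise it lies strictly to the right of the
line; the left contact is `u` only if `vu` is an edge, and otherwise it lies strictly to the left
(`IsOutcome.contacts_of_through`).

*The algorithm.* The left-turn relation is a cyclic order on the vertices of `O`, and everything
about successors in subpolygons follows from its axioms (`IsCyclicallyOrdered`). A true flag certifies
an edge of `O`, and `F` counts the false flags (`State.IsCoherent`). Every iteration finds a vertex or
certifies an edge. The first iteration, when `Q` has two vertices, does two of these at once. There
are `n - 2` vertices to find after the initial probe and `n` edges to certify, which bounds the total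
number of probes by `1 + (n - 2) + n - 1 = 2n - 2` (`Invariant`). When no false flag is left, the
successor of each vertex of `Q` is its successor in `O`, so `Q` is `O` (`State.IsCoherent.verts_eq`).
-/

namespace WedgeProbe

/-! ### Cross products and cones in the plane -/

theorem plane_ext {a b : Plane} (h₀ : a 0 = b 0) (h₁ : a 1 = b 1) : a = b := by
  ext i
  fin_cases i
  · exact h₀
  · exact h₁

theorem cross_swap (a b : Plane) : cross a b = -cross b a := by
  simp only [cross]; ring

theorem cross_self (a : Plane) : cross a a = 0 := by
  simp only [cross]; ring

theorem cross_zero_right (a : Plane) : cross a 0 = 0 := by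
  simp [cross]

theorem cross_add_right (a b c : Plane) : cross a (b + c) = cross a b + cross a c := by
  simp only [cross, PiLp.add_apply]; ring

theorem cross_smul_right (a b : Plane) (t : ℝ) : cross a (t • b) = t * cross a b := by
  simp only [cross, PiLp.smul_apply, smul_eq_mul]; ring

theorem cross_smul_left (a b : Plane) (t : ℝ) : cross (t • a) b = t * cross a b := by
  simp only [cross, PiLp.smul_apply, smul_eq_mul]; ring

theorem inner_eq_coords (a b : Plane) : inner ℝ a b = a 0 * b 0 + a 1 * b 1 := by
  simp [PiLp.inner_apply, Fin.sum_univ_two]; ring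

theorem norm_sq_eq_coords (a : Plane) : ‖a‖ ^ 2 = a 0 ^ 2 + a 1 ^ 2 := by
  rw [← real_inner_self_eq_norm_sq, inner_eq_coords]; ring

/-- Lagrange's identity. -/
theorem cross_sq_add_inner_sq (a b : Plane) :
    cross a b ^ 2 + inner ℝ a b ^ 2 = ‖a‖ ^ 2 * ‖b‖ ^ 2 := by
  rw [norm_sq_eq_coords, norm_sq_eq_coords, inner_eq_coords, cross]; ring

theorem abs_cross_le (a b : Plane) : |cross a b| ≤ ‖a‖ * ‖b‖ := by
  refine abs_le_of_sq_le_sq ?_ (by positivity)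
  nlinarith [cross_sq_add_inner_sq a b, sq_nonneg (inner ℝ a b : ℝ)]

@[fun_prop]
theorem Continuous.cross {X : Type*} [TopologicalSpace X] {f g : X → Plane}
    (hf : Continuous f) (hg : Continuous g) : Continuous fun x => cross (f x) (g x) := by
  unfold WedgeProbe.cross
  fun_prop

/-- Cramer's rule. -/
theorem eq_smul_add_smul {d e : Plane} (h : cross d e ≠ 0) (x : Plane) :
    x = (cross x e / cross d e) • d + (cross d x / cross d e) • e := by
  apply plane_ext <;>
  · simp only [PiLp.add_apply, PiLp.smul_apply, smul_eq_mul]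
    field_simp
    simp only [cross]
    ring

/-- The closed cone with apex `q` spanned by `d` and `e`. The pair `(d, e)` may be oriented either
way, which allows the two arms of a wedge to be treated alike. -/
def cone (q d e : Plane) : Set Plane := {x | ∃ s t : ℝ, 0 ≤ s ∧ 0 ≤ t ∧ x = q + s • d + t • e}

theorem cone_comm (q d e : Plane) : cone q d e = cone q e d := by
  ext x
  constructor <;>
  · rintro ⟨s, t, hs, ht, rfl⟩
    exact ⟨t, s, ht, hs, by abel⟩

theorem mem_cone_iff {q d e x : Plane} (h : 0 < cross d e) :
    x ∈ cone q d e ↔ 0 ≤ cross d (x - q) ∧ 0 ≤ cross (x - q) e := by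
  constructor
  · rintro ⟨s, t, hs, ht, rfl⟩
    have h₁ : cross d (q + s • d + t • e - q) = t * cross d e := by
      simp only [cross, PiLp.sub_apply, PiLp.add_apply, PiLp.smul_apply, smul_eq_mul]; ring
    have h₂ : cross (q + s • d + t • e - q) e = s * cross d e := by
      simp only [cross, PiLp.sub_apply, PiLp.add_apply, PiLp.smul_apply, smul_eq_mul]; ring
    rw [h₁, h₂]
    exact ⟨by positivity, by positivity⟩
  · rintro ⟨h₁, h₂⟩
    refine ⟨_, _, div_nonneg h₂ h.le, div_nonneg h₁ h.le, ?_⟩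
    rw [add_assoc, ← eq_smul_add_smul h.ne', add_sub_cancel]

theorem mem_ray_of_mem_cone {q d e x : Plane} (h : cross d e ≠ 0) (hx : x ∈ cone q d e)
    (hd : cross d (x - q) = 0) : x ∈ ray q d := by
  obtain ⟨s, t, hs, ht, rfl⟩ := hx
  have h₁ : cross d (q + s • d + t • e - q) = t * cross d e := by
    simp only [cross, PiLp.sub_apply, PiLp.add_apply, PiLp.smul_apply, smul_eq_mul]; ring
  rw [h₁] at hd
  obtain rfl : t = 0 := (mul_eq_zero.mp hd).resolve_right h
  exact ⟨s, hs, by simp⟩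

theorem cross_sub_of_mem_ray {q d x : Plane} (hx : x ∈ ray q d) : cross d (x - q) = 0 := by
  obtain ⟨t, -, rfl⟩ := hx
  rw [add_sub_cancel_left, cross_smul_right, cross_self, mul_zero]

/-- The point of a convex body nearest to the apex on an arm of an enclosing cone is an extreme
point, because the arm lies on a supporting line. -/
theorem mem_extremePoints_of_isClosest {O : Set Plane} {q d e x : Plane} (h : cross d e ≠ 0)
    (hO : O ⊆ cone q d e) (hx : IsClosest q (O ∩ ray q d) x) : x ∈ O.extremePoints ℝ := by
  obtain ⟨⟨hxO, a, ha, rfl⟩, hmin⟩ := hx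
  have hd : d ≠ 0 := by rintro rfl; simp [cross] at h
  have hge : ∀ b : ℝ, 0 ≤ b → q + b • d ∈ O → a ≤ b := by
    intro b hb hbO
    have := hmin _ ⟨hbO, b, hb, rfl⟩
    rw [dist_self_add_right, dist_self_add_right, norm_smul, norm_smul, Real.norm_of_nonneg ha,
      Real.norm_of_nonneg hb] at this
    exact le_of_mul_le_mul_right this (norm_pos_iff.mpr hd)
  rw [mem_extremePoints_iff_left (𝕜 := ℝ)]
  refine ⟨hxO, ?_⟩
  intro y hy z hz hyz
  obtain ⟨s, t, hs, ht, rfl⟩ := hO hy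
  obtain ⟨s', t', hs', ht', rfl⟩ := hO hz
  obtain ⟨α, β, hα, hβ, hαβ, heq⟩ := hyz
  have key : (α * s + β * s' - a) • d + (α * t + β * t') • e = 0 := by
    have : α • (q + s • d + t • e) + β • (q + s' • d + t' • e) - (q + a • d) = 0 := by
      rw [heq, sub_self]
    have hβ' : β = 1 - α := by linarith
    subst hβ'
    rw [← this]
    module
  have ht0 : α * t + β * t' = 0 := by
    have := congrArg (cross d) key
    rw [cross_add_right, cross_smul_right, cross_smul_right, cross_self] at this
    rw [cross_zero_right, mul_zero, zero_add] at this
    exact (mul_eq_zero.mp this).resolve_right h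
  have hs0 : α * s + β * s' - a = 0 := by
    rw [ht0, zero_smul, add_zero] at key
    exact (smul_eq_zero.mp key).resolve_right hd
  have h1 : 0 ≤ α * t := by positivity
  have h2 : 0 ≤ β * t' := by positivity
  have ht1 : t = 0 := (mul_eq_zero.mp (by linarith : α * t = 0)).resolve_left hα.ne'
  have ht2 : t' = 0 := (mul_eq_zero.mp (by linarith : β * t' = 0)).resolve_left hβ.ne'
  subst ht1 ht2
  rw [zero_smul, add_zero] at hy hz ⊢
  have h3 := hge s hs hy
  have h4 := hge s' hs' hz
  have : α * (s - a) = 0 := by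
    have : α * (s - a) + β * (s' - a) = 0 := by
      linear_combination hs0 + a * hαβ * (-1)
    nlinarith [mul_nonneg hα.le (sub_nonneg.mpr h3), mul_nonneg hβ.le (sub_nonneg.mpr h4)]
  have : s = a := by
    have := (mul_eq_zero.mp this).resolve_left hα.ne'
    linarith
  rw [this]

/-- Two vectors of a cone of angle at most `π / 2` form an angle at most that of the cone. -/
theorem angle_le_of_mem_cone {ω : ℝ} (hω : ω ≤ Real.pi / 2) {d e x y : Plane} (hd : ‖d‖ = 1)
    (he : ‖e‖ = 1) (hde : InnerProductGeometry.angle d e = ω) (hx : x ∈ cone 0 d e)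
    (hy : y ∈ cone 0 d e) (hx0 : x ≠ 0) (hy0 : y ≠ 0) :
    InnerProductGeometry.angle x y ≤ ω := by
  have hω0 : 0 ≤ ω := hde ▸ InnerProductGeometry.angle_nonneg _ _
  have hωπ : ω ≤ Real.pi := by linarith [Real.pi_pos]
  have hinner : inner ℝ d e = Real.cos ω := by
    rw [← hde, InnerProductGeometry.cos_angle, hd, he]; simp
  have hc0 : 0 ≤ Real.cos ω := Real.cos_nonneg_of_mem_Icc ⟨by linarith [Real.pi_pos], hω⟩
  have hc1 := Real.cos_le_one ω
  have hn : ∀ s t : ℝ, 0 ≤ s → 0 ≤ t → ‖s • d + t • e‖ ≤ s + t := by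
    intro s t hs ht
    refine (norm_add_le _ _).trans ?_
    rw [norm_smul, norm_smul, hd, he, Real.norm_of_nonneg hs, Real.norm_of_nonneg ht]; simp
  obtain ⟨s, t, hs, ht, rfl⟩ := hx
  obtain ⟨s', t', hs', ht', rfl⟩ := hy
  simp only [zero_add] at *
  have hxy : inner ℝ (s • d + t • e) (s' • d + t' • e)
      = s * s' + t * t' + (s * t' + t * s') * Real.cos ω := by
    simp only [inner_add_left, inner_add_right, real_inner_smul_left, real_inner_smul_right,
      real_inner_self_eq_norm_sq, hd, he, hinner, real_inner_comm d e]
    ring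
  rw [InnerProductGeometry.angle, ← Real.arccos_cos hω0 hωπ]
  apply Real.arccos_le_arccos
  rw [hxy, le_div_iff₀ (mul_pos (norm_pos_iff.mpr hx0) (norm_pos_iff.mpr hy0))]
  calc Real.cos ω * (‖s • d + t • e‖ * ‖s' • d + t' • e‖)
      ≤ Real.cos ω * ((s + t) * (s' + t')) := by
        gcongr
        · exact hn s t hs ht
        · exact hn s' t' hs' ht'
    _ ≤ _ := by nlinarith [mul_nonneg hs hs', mul_nonneg ht ht']

/-! ### Convex polygons -/

section Polygon

variable {n : ℕ} {v : Fin n → Plane}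

theorem cross_sub_cyclic (a b c : Plane) : cross (b - a) (c - a) = cross (c - b) (a - b) := by
  simp only [cross, PiLp.sub_apply]; ring

theorem cross_sub_swap (a b c : Plane) : cross (b - a) (c - a) = -cross (c - a) (b - a) :=
  cross_swap _ _

theorem cross_sub_reverse (a b w : Plane) :
    cross (a - b) (w - b) = -cross (b - a) (w - a) := by
  simp only [cross, PiLp.sub_apply]; ring

theorem isCompact_polygon (v : Fin n → Plane) : IsCompact (polygon v) :=
  (Set.finite_range v).isCompact_convexHull (𝕜 := ℝ)

theorem vertex_mem_polygon (v : Fin n → Plane) (i : Fin n) : v i ∈ polygon v :=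
  subset_convexHull _ _ ⟨i, rfl⟩

/-- Three vertices of a convex polygon make a left turn iff their indices are in cyclic order. -/
theorem IsConvexPolygon.ccw_iff (hv : IsConvexPolygon v) (i j k : Fin n) :
    0 < cross (v j - v i) (v k - v i) ↔ (i < j ∧ j < k) ∨ (j < k ∧ k < i) ∨ (k < i ∧ i < j) := by
  have hpos : ∀ i j k : Fin n, (i < j ∧ j < k) ∨ (j < k ∧ k < i) ∨ (k < i ∧ i < j) →
      0 < cross (v j - v i) (v k - v i) := by
    rintro i j k (h | h | h)
    · exact hv.2 i j k h.1 h.2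
    · rw [cross_sub_cyclic]; exact hv.2 j k i h.1 h.2
    · rw [← cross_sub_cyclic]; exact hv.2 k i j h.1 h.2
  refine ⟨fun h => ?_, hpos i j k⟩
  by_contra hc
  have hij : i ≠ j := by rintro rfl; simp [cross] at h
  have hik : i ≠ k := by rintro rfl; simp [cross] at h
  have hjk : j ≠ k := by rintro rfl; simp [cross_self] at h
  have := hpos i k j (by omega)
  rw [cross_sub_swap] at this
  linarith

theorem IsConvexPolygon.injective (hv : IsConvexPolygon v) : Function.Injective v := by
  intro i j hij
  by_contra hne
  obtain ⟨k, hki, hkj⟩ : ∃ k : Fin n, k ≠ i ∧ k ≠ j := by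
    have : ({i, j} : Finset (Fin n)).card < (Finset.univ : Finset (Fin n)).card := by
      have := Finset.card_le_two (a := i) (b := j)
      have := hv.1
      simp only [Finset.card_univ, Fintype.card_fin]; omega
    obtain ⟨k, -, hk⟩ := Finset.exists_mem_notMem_of_card_lt_card this
    simp only [Finset.mem_insert, Finset.mem_singleton, not_or] at hk
    exact ⟨k, hk⟩
  have h₁ := hv.ccw_iff i j k
  have h₂ := hv.ccw_iff j i k
  rw [hij, sub_self] at h₁
  rw [hij, sub_self] at h₂
  simp only [cross, PiLp.zero_apply, zero_mul, sub_zero, lt_irrefl, false_iff] at h₁ h₂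
  omega

theorem IsConvexPolygon.finRotate_val (hv : IsConvexPolygon v) (i : Fin n) :
    (i.val + 1 = n ∧ (finRotate n i).val = 0) ∨
      (i.val + 1 < n ∧ (finRotate n i).val = i.val + 1) := by
  obtain ⟨m, rfl⟩ : ∃ m, n = m + 1 := ⟨n - 1, by have := hv.1; omega⟩
  rw [finRotate_apply]
  rcases eq_or_ne i (Fin.last m) with rfl | h
  · left; simp
  · right
    have hlt := Fin.val_lt_last h
    exact ⟨by omega, Fin.val_add_one_of_lt (Fin.lt_last_iff_ne_last.mpr h)⟩

/-- Every vertex other than the endpoints of an edge lies strictly to the left of that edge. -/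
theorem IsConvexPolygon.edge_pos (hv : IsConvexPolygon v) {i k : Fin n} (hi : k ≠ i)
    (hr : k ≠ finRotate n i) : 0 < cross (v (finRotate n i) - v i) (v k - v i) := by
  rw [hv.ccw_iff]
  have := hv.finRotate_val i
  rw [Ne, Fin.ext_iff] at hi hr
  simp only [Fin.lt_def]
  omega

theorem IsConvexPolygon.finRotate_ne (hv : IsConvexPolygon v) (i : Fin n) : finRotate n i ≠ i := by
  have := hv.finRotate_val i
  have := hv.1
  rw [Ne, Fin.ext_iff]
  omega

theorem IsConvexPolygon.finRotate_ne_symm (hv : IsConvexPolygon v) (i : Fin n) :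
    finRotate n i ≠ (finRotate n).symm i := by
  intro h
  have h' : finRotate n (finRotate n i) = i := by rw [h, Equiv.apply_symm_apply]
  have h1 := hv.finRotate_val i
  have h2 := hv.finRotate_val (finRotate n i)
  rw [h'] at h2
  have := hv.1
  omega

/-- The polygon lies in the left half-plane of each of its edges. -/
theorem IsConvexPolygon.edge_nonneg (hv : IsConvexPolygon v) (i : Fin n) {x : Plane}
    (hx : x ∈ polygon v) : 0 ≤ cross (v (finRotate n i) - v i) (x - v i) := by
  have hconv : Convex ℝ {x : Plane | 0 ≤ cross (v (finRotate n i) - v i) (x - v i)} := by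
    intro y hy z hz a b ha hb hab
    simp only [Set.mem_ofPred_eq] at *
    have : cross (v (finRotate n i) - v i) (a • y + b • z - v i)
        = a * cross (v (finRotate n i) - v i) (y - v i)
          + b * cross (v (finRotate n i) - v i) (z - v i) := by
      rw [← cross_smul_right, ← cross_smul_right, ← cross_add_right]
      congr 1
      obtain rfl : b = 1 - a := by linarith
      module
    rw [this]
    positivity
  refine convexHull_min ?_ hconv hx
  rintro _ ⟨k, rfl⟩
  simp only [Set.mem_ofPred_eq]
  by_cases h1 : k = i
  · simp [h1, cross]
  by_cases h2 : k = finRotate n i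
  · simp [h2, cross_self]
  exact (hv.edge_pos h1 h2).le

/-- Both edges at a vertex support the polygon, so a segment of the polygon that passes through the
vertex lies on both of them. -/
theorem IsConvexPolygon.vertex_mem_extremePoints (hv : IsConvexPolygon v) (i : Fin n) :
    v i ∈ (polygon v).extremePoints ℝ := by
  rw [mem_extremePoints_iff_left (𝕜 := ℝ)]
  refine ⟨vertex_mem_polygon v i, ?_⟩
  intro y hy z hz hyz
  obtain ⟨α, β, hα, hβ, hαβ, heq⟩ := hyz
  set j := (finRotate n).symm i with hj
  have hji : finRotate n j = i := by rw [hj, Equiv.apply_symm_apply]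
  have hy1 := hv.edge_nonneg i hy
  have hz1 := hv.edge_nonneg i hz
  have hy2 := hv.edge_nonneg j hy
  have hz2 := hv.edge_nonneg j hz
  have hpos := hv.edge_pos (i := j) (k := finRotate n i) (hv.finRotate_ne_symm i)
    (by rw [hji]; exact hv.finRotate_ne i)
  rw [hji] at hy2 hz2 hpos
  have hzero : α • (y - v i) + β • (z - v i) = 0 := by
    obtain rfl : β = 1 - α := by linarith
    have : α • y + (1 - α) • z - v i = 0 := by rw [heq, sub_self]
    rw [← this]; module
  have hmove : ∀ w : Plane, cross (v i - v j) (w - v j) = cross (v i - v j) (w - v i) := by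
    intro w; simp only [cross, PiLp.sub_apply]; ring
  rw [hmove] at hy2 hz2 hpos
  have hvan : ∀ a : Plane, 0 ≤ cross a (y - v i) → 0 ≤ cross a (z - v i) →
      cross a (y - v i) = 0 := by
    intro a h1 h2
    have := congrArg (cross a) hzero
    rw [cross_add_right, cross_smul_right, cross_smul_right, cross_zero_right] at this
    nlinarith [mul_nonneg hα.le h1, mul_nonneg hβ.le h2]
  have e1 := hvan _ hy1 hz1
  have e2 := hvan _ hy2 hz2
  have := eq_smul_add_smul hpos.ne' (y - v i)
  rw [e2, cross_swap (y - v i), e1] at this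
  simpa [sub_eq_zero] using this

/-- Since all internal angles exceed `ω`, an enclosing `ω`-wedge has its apex outside the
polygon. -/
theorem apex_notMem_polygon {ω : ℝ} (hω : ω ≤ Real.pi / 2) (hv : IsConvexPolygon v)
    (hangle : ∀ i, ω < internalAngle v i) {W : Wedge} (hW : W.IsOmegaWedge ω)
    (hO : polygon v ⊆ W.region) : W.apex ∉ polygon v := by
  obtain ⟨hd, he, hde, hcr⟩ := hW
  intro hq
  have hcl : IsClosest W.apex (polygon v ∩ ray W.apex W.dir₁) W.apex :=
    ⟨⟨hq, 0, le_rfl, by simp⟩, fun y _ => by simp [dist_nonneg]⟩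
  obtain ⟨i, hi⟩ := extremePoints_convexHull_subset
    (mem_extremePoints_of_isClosest hcr.ne' hO hcl)
  have hmem : ∀ j, v j - v i ∈ cone 0 W.dir₁ W.dir₂ := by
    intro j
    obtain ⟨s, t, hs, ht, h⟩ := hO (vertex_mem_polygon v j)
    exact ⟨s, t, hs, ht, by rw [h, hi]; abel⟩
  have h1 : v ((finRotate n).symm i) - v i ≠ 0 := by
    rw [sub_ne_zero]
    intro h
    have h := hv.injective h
    rw [Equiv.symm_apply_eq] at h
    exact hv.finRotate_ne i h.symm
  have h2 : v (finRotate n i) - v i ≠ 0 := by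
    rw [sub_ne_zero]
    exact fun h => hv.finRotate_ne i (hv.injective h)
  have := angle_le_of_mem_cone hω hd he hde (hmem _) (hmem _) h1 h2
  exact absurd (hangle i) (not_lt.mpr this)

end Polygon

/-! ### Existence of probes -/

/-- The rotation of `d` about the origin by the angle `θ`, counter-clockwise. -/
noncomputable def rot (θ : ℝ) (d : Plane) : Plane :=
  !₂[Real.cos θ * d 0 - Real.sin θ * d 1, Real.sin θ * d 0 + Real.cos θ * d 1]

theorem rot_apply_zero (θ : ℝ) (d : Plane) :
    rot θ d 0 = Real.cos θ * d 0 - Real.sin θ * d 1 := rfl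

theorem rot_apply_one (θ : ℝ) (d : Plane) :
    rot θ d 1 = Real.sin θ * d 0 + Real.cos θ * d 1 := rfl

@[fun_prop]
theorem Continuous.rot {X : Type*} [TopologicalSpace X] {f : X → ℝ} {g : X → Plane}
    (hf : Continuous f) (hg : Continuous g) : Continuous fun x => rot (f x) (g x) := by
  refine (PiLp.continuous_toLp 2 _).comp (continuous_pi fun i => ?_)
  fin_cases i
  · simp only [Fin.zero_eta, Matrix.cons_val_zero]; fun_prop
  · simp only [Fin.mk_one, Matrix.cons_val_one, Matrix.cons_val_fin_one]; fun_prop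

theorem rot_zero (d : Plane) : rot 0 d = d := by
  apply plane_ext <;> simp [rot_apply_zero, rot_apply_one]

theorem rot_rot (α β : ℝ) (d : Plane) : rot α (rot β d) = rot (α + β) d := by
  apply plane_ext <;>
  · simp only [rot_apply_zero, rot_apply_one, Real.cos_add, Real.sin_add]; ring

theorem norm_rot (θ : ℝ) (d : Plane) : ‖rot θ d‖ = ‖d‖ := by
  rw [← sq_eq_sq₀ (norm_nonneg _) (norm_nonneg _), norm_sq_eq_coords, norm_sq_eq_coords,
    rot_apply_zero, rot_apply_one]
  linear_combination (d 0 ^ 2 + d 1 ^ 2) * Real.sin_sq_add_cos_sq θ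

theorem inner_rot_right (θ : ℝ) (d : Plane) :
    inner ℝ d (rot θ d) = Real.cos θ * ‖d‖ ^ 2 := by
  rw [norm_sq_eq_coords, inner_eq_coords, rot_apply_zero, rot_apply_one]; ring

theorem cross_self_rot (θ : ℝ) (d : Plane) : cross d (rot θ d) = Real.sin θ * ‖d‖ ^ 2 := by
  rw [norm_sq_eq_coords, cross, rot_apply_zero, rot_apply_one]; ring

/-- A unit vector and its rotation by `ω` span an `ω`-wedge. -/
theorem isOmegaWedge_rot {ω : ℝ} (hω₀ : 0 < ω) (hω : ω ≤ Real.pi / 2) (q : Plane) {d : Plane}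
    (hd : ‖d‖ = 1) : Wedge.IsOmegaWedge ω ⟨q, d, rot ω d⟩ := by
  have := Real.pi_pos
  refine ⟨hd, by rw [norm_rot, hd], ?_, ?_⟩
  · rw [InnerProductGeometry.angle, norm_rot, inner_rot_right, hd]
    simpa using Real.arccos_cos hω₀.le (by linarith)
  · rw [cross_self_rot, hd]
    simpa using Real.sin_pos_of_pos_of_lt_pi hω₀ (by linarith)

/-- The second arm of an `ω`-wedge is the first one turned by `ω`. -/
theorem Wedge.IsOmegaWedge.dir₂_eq {ω : ℝ} {W : Wedge} (hW : W.IsOmegaWedge ω) (hω₀ : 0 < ω)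
    (hω : ω ≤ Real.pi / 2) : W.dir₂ = rot ω W.dir₁ := by
  obtain ⟨hd, he, hde, hcr⟩ := hW
  have hpi := Real.pi_pos
  have hc : inner ℝ W.dir₁ W.dir₂ = Real.cos ω := by
    rw [← hde, InnerProductGeometry.cos_angle, hd, he]; simp
  have hs : cross W.dir₁ W.dir₂ = Real.sin ω := by
    have hL := cross_sq_add_inner_sq W.dir₁ W.dir₂
    rw [hd, he, hc] at hL
    rw [← sq_eq_sq₀ hcr.le (Real.sin_nonneg_of_nonneg_of_le_pi hω₀.le (by linarith)), Real.sin_sq]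
    linarith
  have hn := norm_sq_eq_coords W.dir₁
  rw [hd] at hn
  rw [inner_eq_coords] at hc
  rw [cross] at hs
  apply plane_ext
  · rw [rot_apply_zero, ← hc, ← hs]; linear_combination W.dir₂ 0 * hn
  · rw [rot_apply_one, ← hc, ← hs]; linear_combination W.dir₂ 1 * hn

theorem convex_cone (q d e : Plane) : Convex ℝ (cone q d e) := by
  rintro _ ⟨s, t, hs, ht, rfl⟩ _ ⟨s', t', hs', ht', rfl⟩ a b ha hb hab
  refine ⟨a * s + b * s', a * t + b * t', by positivity, by positivity, ?_⟩
  obtain rfl : b = 1 - a := by linarith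
  module

/-- Turning the second arm outwards by an acute angle puts every point other than the apex strictly
on the inner side of it. -/
theorem cross_rot_pos_of_mem_cone {ω ε : ℝ} (hω₀ : 0 < ω) (hω : ω ≤ Real.pi / 2) (hε₀ : 0 < ε)
    (hε : ε < Real.pi / 2) {d x : Plane} (hd : ‖d‖ = 1) (hx : x ∈ cone 0 d (rot ω d))
    (hx0 : x ≠ 0) : 0 < cross x (rot ε (rot ω d)) ∧ 0 < cross (rot (-ε) d) x := by
  have hpi := Real.pi_pos
  have hsω : 0 < Real.sin ω := Real.sin_pos_of_pos_of_lt_pi hω₀ (by linarith)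
  have hcω : 0 ≤ Real.cos ω := Real.cos_nonneg_of_mem_Icc ⟨by linarith, hω⟩
  have hsε : 0 < Real.sin ε := Real.sin_pos_of_pos_of_lt_pi hε₀ (by linarith)
  have hcε : 0 < Real.cos ε := Real.cos_pos_of_mem_Ioo ⟨by linarith, hε⟩
  obtain ⟨s, t, hs, ht, rfl⟩ := hx
  have hn := norm_sq_eq_coords d
  rw [hd] at hn
  have hsc := Real.sin_sq_add_cos_sq ω
  have h₁ : cross (0 + s • d + t • rot ω d) (rot ε (rot ω d))
      = Real.cos ε * (s * Real.sin ω) + Real.sin ε * (s * Real.cos ω + t) := by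
    simp only [cross, PiLp.add_apply, PiLp.smul_apply, smul_eq_mul, PiLp.zero_apply,
      rot_apply_zero, rot_apply_one]
    linear_combination (-(Real.cos ε * (s * Real.sin ω) + Real.sin ε * (s * Real.cos ω)
      + t * Real.sin ε * (Real.sin ω ^ 2 + Real.cos ω ^ 2))) * hn
      + t * Real.sin ε * hsc
  have h₂ : cross (rot (-ε) d) (0 + s • d + t • rot ω d)
      = Real.cos ε * (t * Real.sin ω) + Real.sin ε * (s + t * Real.cos ω) := by
    simp only [cross, PiLp.add_apply, PiLp.smul_apply, smul_eq_mul, PiLp.zero_apply,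
      rot_apply_zero, rot_apply_one, Real.cos_neg, Real.sin_neg]
    linear_combination (-(Real.cos ε * (t * Real.sin ω) + Real.sin ε * (s + t * Real.cos ω))) * hn
  rw [h₁, h₂]
  rcases hs.eq_or_lt with rfl | hs
  · rcases ht.eq_or_lt with rfl | ht
    · simp at hx0
    · constructor
      · rw [zero_mul, zero_mul, mul_zero, zero_add, zero_add]; positivity
      · positivity
  · constructor <;> positivity

/-- The direction of the line bisects the initial wedge, and the apex is moved back far enough for
the disk to fit in. -/
theorem exists_isInitialPlacement {ω : ℝ} (hω₀ : 0 < ω) (hω : ω ≤ Real.pi / 2) (c : Plane) (r : ℝ)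
    (L : DirectedLine) : ∃ W₀, IsInitialPlacement ω (Metric.closedBall c r) L W₀ := by
  have hpi := Real.pi_pos
  have hsin : 0 < Real.sin (ω / 2) := Real.sin_pos_of_pos_of_lt_pi (by linarith) (by linarith)
  have hN : 0 < ‖L.dir‖ := norm_pos_iff.mpr L.dir_ne_zero
  set e : Plane := ‖L.dir‖⁻¹ • L.dir with he
  have hen : ‖e‖ = 1 := by
    rw [he, norm_smul, norm_inv, norm_norm, inv_mul_cancel₀ hN.ne']
  have hdir : L.dir = ‖L.dir‖ • e := by rw [he, smul_smul, mul_inv_cancel₀ hN.ne', one_smul]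
  set M : ℝ := (r + ‖c - L.point‖) / Real.sin (ω / 2) with hM
  set q : Plane := L.point + (-M) • e with hq
  have hW := isOmegaWedge_rot hω₀ hω q (d := rot (-(ω / 2)) e) (by rw [norm_rot, hen])
  have hd₂ : rot ω (rot (-(ω / 2)) e) = rot (ω / 2) e := by rw [rot_rot]; congr 1; ring
  rw [hd₂] at hW
  have h₁ : cross (rot (-(ω / 2)) e) e = Real.sin (ω / 2) := by
    rw [cross_swap, cross_self_rot, hen, Real.sin_neg]; ring
  have h₂ : cross e (rot (ω / 2) e) = Real.sin (ω / 2) := by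
    rw [cross_self_rot, hen]; ring
  refine ⟨⟨q, rot (-(ω / 2)) e, rot (ω / 2) e⟩, hW, ?_, ?_, ?_⟩
  · refine ⟨-M * ‖L.dir‖⁻¹, ?_⟩
    simp only [hq, he, smul_smul]
  · intro x hx
    refine (mem_cone_iff hW.2.2.2).mpr ?_
    have hxq : x - q = (x - L.point) + M • e := by rw [hq]; module
    have hB : ‖x - L.point‖ ≤ r + ‖c - L.point‖ := by
      have h := norm_add_le (x - c) (c - L.point)
      rw [sub_add_sub_cancel] at h
      have := mem_closedBall_iff_norm.mp hx
      linarith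
    have hMs : M * Real.sin (ω / 2) = r + ‖c - L.point‖ := div_mul_cancel₀ _ hsin.ne'
    dsimp only
    constructor
    · rw [hxq, cross_add_right, cross_smul_right, h₁, hMs]
      have := abs_cross_le (rot (-(ω / 2)) e) (x - L.point)
      rw [norm_rot, hen, one_mul] at this
      linarith [neg_abs_le (cross (rot (-(ω / 2)) e) (x - L.point))]
    · rw [hxq, cross_swap, cross_add_right, cross_smul_right, cross_swap _ e, h₂]
      have := abs_cross_le (rot (ω / 2) e) (x - L.point)
      rw [norm_rot, hen, one_mul] at this
      linarith [le_abs_self (cross (rot (ω / 2) e) (x - L.point))]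
  · rintro x ⟨t, ht, rfl⟩
    refine (mem_cone_iff hW.2.2.2).mpr ?_
    dsimp only
    rw [add_sub_cancel_left, hdir, cross_smul_right, cross_smul_right, cross_smul_left,
      cross_smul_left, h₁, h₂]
    constructor <;> positivity

section

variable {n : ℕ} {v : Fin n → Plane} {ω : ℝ}

theorem polygon_subset_cone {q d e : Plane} (h : ∀ i, v i ∈ cone q d e) :
    polygon v ⊆ cone q d e :=
  convexHull_min (by rintro _ ⟨i, rfl⟩; exact h i) (convex_cone q d e)

/-- If some arm of an enclosing `ω`-wedge misses the polygon, then a small rotation keeps the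
polygon in the wedge and makes both arms miss it. -/
theorem exists_strictly_enclosing (hω₀ : 0 < ω) (hω : ω ≤ Real.pi / 2) {q d : Plane}
    (hd : ‖d‖ = 1) (hq : ∀ i, v i ≠ q) (hO : ∀ i, v i ∈ cone q d (rot ω d))
    (hfree : (∀ i, 0 < cross d (v i - q)) ∨ ∀ i, 0 < cross (v i - q) (rot ω d)) :
    ∃ d', ‖d'‖ = 1 ∧ ∀ i, 0 < cross d' (v i - q) ∧ 0 < cross (v i - q) (rot ω d') := by
  have hpi := Real.pi_pos
  have hmem : ∀ i, v i - q ∈ cone 0 d (rot ω d) := by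
    intro i
    obtain ⟨s, t, hs, ht, h⟩ := hO i
    exact ⟨s, t, hs, ht, by rw [h]; abel⟩
  have hpos : ∀ᶠ ε : ℝ in nhdsWithin 0 (Set.Ioi 0), 0 < ε ∧ ε < Real.pi / 2 := by
    filter_upwards [self_mem_nhdsWithin,
      nhdsWithin_le_nhds (Iio_mem_nhds (by linarith : (0 : ℝ) < Real.pi / 2))] with ε h₁ h₂
    exact ⟨h₁, h₂⟩
  rcases hfree with hfree | hfree
  · have hev : ∀ᶠ ε : ℝ in nhdsWithin 0 (Set.Ioi 0), ∀ i, 0 < cross (rot ε d) (v i - q) := by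
      refine Filter.eventually_all.mpr fun i => nhdsWithin_le_nhds ?_
      have hc : Continuous fun ε : ℝ => cross (rot ε d) (v i - q) := by fun_prop
      exact hc.continuousAt.eventually (lt_mem_nhds (by dsimp only; rw [rot_zero]; exact hfree i))
    obtain ⟨ε, h₁, h₂⟩ := (hev.and hpos).exists
    refine ⟨rot ε d, by rw [norm_rot, hd], fun i => ⟨h₁ i, ?_⟩⟩
    rw [rot_rot, add_comm, ← rot_rot]
    exact (cross_rot_pos_of_mem_cone hω₀ hω h₂.1 h₂.2 hd (hmem i) (sub_ne_zero.mpr (hq i))).1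
  · have hev : ∀ᶠ ε : ℝ in nhdsWithin 0 (Set.Ioi 0),
        ∀ i, 0 < cross (v i - q) (rot ω (rot (-ε) d)) := by
      refine Filter.eventually_all.mpr fun i => nhdsWithin_le_nhds ?_
      have hc : Continuous fun ε : ℝ => cross (v i - q) (rot ω (rot (-ε) d)) := by fun_prop
      exact hc.continuousAt.eventually
        (lt_mem_nhds (by dsimp only; rw [neg_zero, rot_zero]; exact hfree i))
    obtain ⟨ε, h₁, h₂⟩ := (hev.and hpos).exists
    refine ⟨rot (-ε) d, by rw [norm_rot, hd], fun i => ⟨?_, h₁ i⟩⟩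
    exact (cross_rot_pos_of_mem_cone hω₀ hω h₂.1 h₂.2 hd (hmem i) (sub_ne_zero.mpr (hq i))).2

/-- Moving forward along a line from an enclosing `ω`-wedge towards a point `q₀ + τ • e` of the
polygon, the last apex that admits an enclosing `ω`-wedge admits one with both arms touching. -/
theorem exists_isValidProbe (hω₀ : 0 < ω) (hω : ω ≤ Real.pi / 2) (hv : IsConvexPolygon v)
    (hangle : ∀ i, ω < internalAngle v i) {q₀ e : Plane} {τ : ℝ} (hτ : 0 ≤ τ)
    (hz : q₀ + τ • e ∈ polygon v) {W₀ : Wedge} (hW₀ : W₀.IsOmegaWedge ω) (hq₀ : W₀.apex = q₀)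
    (hO : polygon v ⊆ W₀.region) :
    ∃ W : Wedge, W.IsValidProbe ω (polygon v) ∧ ∃ t, 0 ≤ t ∧ t ≤ τ ∧ W.apex = q₀ + t • e := by
  have hpi := Real.pi_pos
  set K : Set (ℝ × Plane) := {x | x.1 ∈ Set.Icc 0 τ ∧ x.2 ∈ Metric.sphere (0 : Plane) 1 ∧
    ∀ i, 0 ≤ cross x.2 (v i - (q₀ + x.1 • e)) ∧
      0 ≤ cross (v i - (q₀ + x.1 • e)) (rot ω x.2)} with hK
  have hKc : IsCompact K := by
    have hclosed : IsClosed {x : ℝ × Plane | ∀ i, 0 ≤ cross x.2 (v i - (q₀ + x.1 • e)) ∧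
        0 ≤ cross (v i - (q₀ + x.1 • e)) (rot ω x.2)} := by
      simp only [Set.ofPred_forall, Set.ofPred_and]
      refine isClosed_iInter fun i => IsClosed.inter ?_ ?_
      · exact isClosed_le (by fun_prop) (by fun_prop)
      · exact isClosed_le (by fun_prop) (by fun_prop)
    have := ((isCompact_Icc (a := (0 : ℝ)) (b := τ)).prod
      (isCompact_sphere (0 : Plane) 1)).inter_right hclosed
    convert this using 1
    ext x
    simp only [hK, Set.mem_ofPred_eq, Set.mem_inter_iff, Set.mem_prod, and_assoc]
  have hmemK : ∀ {t : ℝ} {d : Plane}, ‖d‖ = 1 → ((∀ i, v i ∈ cone (q₀ + t • e) d (rot ω d)) ↔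
      ∀ i, 0 ≤ cross d (v i - (q₀ + t • e)) ∧ 0 ≤ cross (v i - (q₀ + t • e)) (rot ω d)) := by
    intro t d hd
    have hcr := (isOmegaWedge_rot hω₀ hω 0 hd).2.2.2
    exact forall_congr' fun i => mem_cone_iff hcr
  have hKne : K.Nonempty := by
    refine ⟨(0, W₀.dir₁), ⟨le_rfl, hτ⟩, by simpa using hW₀.1, (hmemK hW₀.1).mp fun i => ?_⟩
    rw [zero_smul, add_zero, ← hq₀, ← hW₀.dir₂_eq hω₀ hω]
    exact hO (vertex_mem_polygon v i)
  obtain ⟨⟨T, d⟩, ⟨hT, hd, hTd⟩, hmax⟩ := hKc.exists_isMaxOn hKne continuous_fst.continuousOn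
  replace hd : ‖d‖ = 1 := by simpa using hd
  simp only at hT hTd
  have hW := isOmegaWedge_rot hω₀ hω (q₀ + T • e) hd
  have hcone := (hmemK hd).mpr hTd
  have hsub := polygon_subset_cone hcone
  have hqO : q₀ + T • e ∉ polygon v := apex_notMem_polygon hω hv hangle hW hsub
  have hTτ : T < τ := lt_of_le_of_ne hT.2 (by rintro rfl; exact hqO hz)
  have hne : ∀ i, v i ≠ q₀ + T • e := fun i h => hqO (h ▸ vertex_mem_polygon v i)
  have htouch : ¬ ((∀ i, 0 < cross d (v i - (q₀ + T • e))) ∨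
      ∀ i, 0 < cross (v i - (q₀ + T • e)) (rot ω d)) := by
    intro hfree
    obtain ⟨d', hd', hpos⟩ := exists_strictly_enclosing hω₀ hω hd hne hcone hfree
    have hev : ∀ᶠ t in nhdsWithin T (Set.Ioi T), ∀ i, 0 < cross d' (v i - (q₀ + t • e)) ∧
        0 < cross (v i - (q₀ + t • e)) (rot ω d') := by
      refine Filter.eventually_all.mpr fun i => nhdsWithin_le_nhds (Filter.Eventually.and ?_ ?_)
      · have hc : Continuous fun t : ℝ => cross d' (v i - (q₀ + t • e)) := by fun_prop
        exact hc.continuousAt.eventually (lt_mem_nhds (hpos i).1)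
      · have hc : Continuous fun t : ℝ => cross (v i - (q₀ + t • e)) (rot ω d') := by fun_prop
        exact hc.continuousAt.eventually (lt_mem_nhds (hpos i).2)
    obtain ⟨t, ht, htT, htτ⟩ := (hev.and (Ioo_mem_nhdsGT hTτ)).exists
    have htK : (t, d') ∈ K :=
      ⟨⟨hT.1.trans htT.le, htτ.le⟩, by simpa using hd', fun i => ⟨(ht i).1.le, (ht i).2.le⟩⟩
    have := hmax htK
    simp only [Set.mem_ofPred_eq] at this
    linarith
  simp only [not_or, not_forall, not_lt] at htouch
  obtain ⟨⟨i, hi⟩, j, hj⟩ := htouch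
  refine ⟨⟨q₀ + T • e, d, rot ω d⟩, ⟨hW, hsub, ?_, ?_⟩, T, hT.1, hT.2, rfl⟩
  · exact ⟨v i, vertex_mem_polygon v i,
      mem_ray_of_mem_cone hW.2.2.2.ne' (hcone i) (le_antisymm hi (hTd i).1)⟩
  · refine ⟨v j, vertex_mem_polygon v j, mem_ray_of_mem_cone (e := d) ?_ ?_ ?_⟩
    · rw [cross_swap, neg_ne_zero]; exact hW.2.2.2.ne'
    · rw [cone_comm]; exact hcone j
    · rw [cross_swap, neg_eq_zero]; exact le_antisymm hj (hTd j).2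

theorem isClosed_ray (q d : Plane) : IsClosed (ray q d) := by
  rcases eq_or_ne d 0 with rfl | hd
  · have : ray q 0 = {q} := by
      ext x
      simp only [ray, smul_zero, add_zero, Set.mem_ofPred_eq, Set.mem_singleton_iff]
      exact ⟨fun ⟨_, _, h⟩ => h, fun h => ⟨0, le_rfl, h⟩⟩
    rw [this]; exact isClosed_singleton
  · have : ray q d = (fun x => q + x) '' ((fun t : ℝ => t • d) '' Set.Ici 0) := by
      ext x
      simp only [ray, Set.mem_ofPred_eq, Set.mem_image, Set.mem_Ici, exists_exists_and_eq_and]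
      exact exists_congr fun t => and_congr_right fun _ => eq_comm
    rw [this]
    exact (Homeomorph.addLeft q).isClosedMap _
      ((isClosedEmbedding_smul_left hd).isClosedMap _ isClosed_Ici)

theorem exists_isClosest {O : Set Plane} (hO : IsCompact O) {q d : Plane}
    (hne : (O ∩ ray q d).Nonempty) : ∃ x, IsClosest q (O ∩ ray q d) x := by
  obtain ⟨x, hx, hmin⟩ := (hO.inter_right (isClosed_ray q d)).exists_isMinOn hne
    (f := fun y => dist q y) (by fun_prop)
  exact ⟨x, hx, fun y hy => hmin hy⟩

/-- Every directed line that meets the polygon can be probed. -/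
theorem canProbe_of_meets (hω₀ : 0 < ω) (hω : ω ≤ Real.pi / 2) (hv : IsConvexPolygon v)
    (hangle : ∀ i, ω < internalAngle v i) {c : Plane} {r : ℝ}
    (hΨ : polygon v ⊆ Metric.closedBall c r) {L : DirectedLine} {z : Plane} (hzL : z ∈ L.points)
    (hz : z ∈ polygon v) : CanProbe ω (polygon v) (Metric.closedBall c r) L := by
  refine ⟨exists_isInitialPlacement hω₀ hω c r L, fun W₀ hW₀ => ?_⟩
  obtain ⟨hW, ⟨a, ha⟩, hball, hray⟩ := hW₀
  obtain ⟨b, hb⟩ := hzL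
  have hsub := hΨ.trans hball
  have hq := apex_notMem_polygon hω hv hangle hW hsub
  have hzq : z = W₀.apex + (b - a) • L.dir := by rw [ha, hb]; module
  have hcr := hW.2.2.2
  -- The wedge contains the forward ray and is pointed, so the polygon cannot lie behind the apex.
  have hτ : 0 ≤ b - a := by
    by_contra! hneg
    have h₁ := (mem_cone_iff hcr).mp (hsub hz)
    have h₂ := (mem_cone_iff hcr).mp (hray ⟨1, zero_le_one, rfl⟩)
    rw [hzq, add_sub_cancel_left, cross_smul_right, cross_smul_left] at h₁
    rw [add_sub_cancel_left, one_smul] at h₂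
    have e₁ : cross W₀.dir₁ L.dir = 0 := by nlinarith
    have e₂ : cross L.dir W₀.dir₂ = 0 := by nlinarith
    have := eq_smul_add_smul hcr.ne' L.dir
    rw [e₁, e₂] at this
    exact L.dir_ne_zero (by simpa using this)
  rw [hzq] at hz
  obtain ⟨W, hWv, t, ht, htτ, hWt⟩ := exists_isValidProbe hω₀ hω hv hangle hτ hz hW rfl hsub
  obtain ⟨p₁, hp₁⟩ := exists_isClosest (isCompact_polygon v) hWv.2.2.1
  obtain ⟨p₂, hp₂⟩ := exists_isClosest (isCompact_polygon v) hWv.2.2.2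
  refine ⟨⟨W, p₁, p₂⟩, ⟨hWv, ⟨a + t, ?_⟩, ⟨_, ⟨b - a - t, sub_nonneg.mpr htτ, ?_⟩, hz⟩⟩,
    ⟨t, ht, hWt⟩, hp₁, hp₂⟩
  · rw [hWt, ha]; module
  · rw [hWt]; module

/-! ### What a probe reveals -/

/-- The contact points of a probe are distinct vertices. -/
theorem IsOutcome.contact_vertices (hω : ω ≤ Real.pi / 2) (hv : IsConvexPolygon v)
    (hangle : ∀ i, ω < internalAngle v i) {L : DirectedLine} {W₀ : Wedge} {o : Outcome}
    (ho : IsOutcome ω (polygon v) L W₀ o) :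
    o.p₁ ∈ Set.range v ∧ o.p₂ ∈ Set.range v ∧ o.p₁ ≠ o.p₂ := by
  obtain ⟨⟨⟨hW, hsub, -, -⟩, -, -⟩, -, h₁, h₂⟩ := ho
  have hcr := hW.2.2.2
  refine ⟨extremePoints_convexHull_subset (mem_extremePoints_of_isClosest hcr.ne' hsub h₁),
    extremePoints_convexHull_subset (mem_extremePoints_of_isClosest (e := o.wedge.dir₁)
      (by rw [cross_swap, neg_ne_zero]; exact hcr.ne') (by rw [cone_comm]; exact hsub) h₂), ?_⟩
  intro heq
  have hc₁ := cross_sub_of_mem_ray h₁.1.2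
  have hc₂ := cross_sub_of_mem_ray h₂.1.2
  rw [heq] at hc₁
  have := eq_smul_add_smul hcr.ne' (o.p₂ - o.wedge.apex)
  rw [hc₁, cross_swap, hc₂] at this
  have : o.p₂ = o.wedge.apex := by simpa [sub_eq_zero] using this
  exact apex_notMem_polygon hω hv hangle hW hsub (this ▸ h₂.1.1)

/-- The polygon is in front of the apex: the apex lies outside, and the ray from it meets the
polygon. -/
theorem exists_apex_behind {O : Set Plane} (hO : Convex ℝ O) {q a b : Plane} (ha : a ∈ O)
    (hb : b ∈ O) (hq : q ∉ O) (hqL : ∃ t : ℝ, q = a + t • (b - a))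
    (hray : (ray q (b - a) ∩ O).Nonempty) : ∃ s : ℝ, 0 < s ∧ a - q = s • (b - a) := by
  obtain ⟨t, rfl⟩ := hqL
  obtain ⟨_, ⟨t', ht', rfl⟩, hy⟩ := hray
  refine ⟨-t, ?_, by module⟩
  by_contra! ht
  apply hq
  rcases le_or_gt t 1 with h1 | h1
  · exact hO.add_smul_sub_mem ha hb ⟨by linarith, h1⟩
  · -- the apex lies between `a` and a point of the polygon in front of it
    have := hO.add_smul_sub_mem ha hy (t := t / (t + t')) ⟨by positivity, by
      rw [div_le_one (by linarith)]; linarith⟩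
    have heq : a + (t / (t + t')) • (a + t • (b - a) + t' • (b - a) - a) = a + t • (b - a) := by
      have h : (t / (t + t')) * (t + t') = t := div_mul_cancel₀ _ (by linarith)
      calc _ = a + ((t / (t + t')) * (t + t')) • (b - a) := by module
        _ = _ := by rw [h]
    rwa [heq] at this

/-- If an arm of the probe runs along the line through `a` and `b`, its contact point is not `b`,
because `a` is nearer to the apex. -/
theorem IsClosest.ne_far_point {O : Set Plane} {q a b d : Plane} (hab : a ≠ b) (ha : a ∈ O)
    {s : ℝ} (hs : 0 < s) (haq : a - q = s • (b - a)) {x : Plane}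
    (hx : IsClosest q (O ∩ ray q d) x) : x ≠ b := by
  rintro rfl
  obtain ⟨⟨-, t, ht, hxt⟩, hmin⟩ := hx
  have hxq : x - q = (s + 1) • (x - a) := by
    rw [add_smul, one_smul, ← haq]; abel
  have hxd : x - q = t • d := by rw [hxt, add_sub_cancel_left]
  have haray : a ∈ ray q d := by
    refine ⟨s / (s + 1) * t, by positivity, ?_⟩
    rw [mul_smul, ← hxd, hxq, smul_smul, div_mul_cancel₀ _ (by linarith), ← haq,
      add_sub_cancel]
  have := hmin a ⟨ha, haray⟩
  rw [dist_comm, dist_comm q, dist_eq_norm, dist_eq_norm, hxq, haq, norm_smul, norm_smul,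
    Real.norm_of_nonneg hs.le, Real.norm_of_nonneg (by linarith)] at this
  have hpos : 0 < ‖x - a‖ := norm_pos_iff.mpr (sub_ne_zero.mpr hab.symm)
  nlinarith

end

/-! ### The cyclic order of the vertices -/

/-- The left-turn relation on `P` is a strict cyclic order, and every point of `P` is a vertex of
its convex hull. This is all that the bookkeeping of the algorithm needs to know about the vertex
set of the polygon. -/
structure IsCyclicallyOrdered (P : Finset Plane) : Prop where
  total : ∀ a ∈ P, ∀ b ∈ P, ∀ c ∈ P, a ≠ b → a ≠ c → b ≠ c →
    0 < cross (b - a) (c - a) ∨ 0 < cross (c - a) (b - a)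
  trans : ∀ a ∈ P, ∀ b ∈ P, ∀ c ∈ P, ∀ d ∈ P, 0 < cross (b - a) (c - a) →
    0 < cross (c - a) (d - a) → 0 < cross (b - a) (d - a)
  extreme : ∀ a ∈ P, a ∈ (convexHull ℝ (P : Set Plane)).extremePoints ℝ

theorem cross_asymm {a b : Plane} (h : 0 < cross a b) : ¬ 0 < cross b a := by
  rw [cross_swap b a]; linarith

theorem IsCcwSucc.unique {V : Finset Plane} {a b c : Plane} (hb : IsCcwSucc V a b)
    (hc : IsCcwSucc V a c) : b = c := by
  by_contra hne
  exact cross_asymm (hb.2.2.2 c hc.2.1 hc.2.2.1.symm (Ne.symm hne))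
    (hc.2.2.2 b hb.2.1 hb.2.2.1.symm hne)

theorem IsCcwSucc.mono {V V' : Finset Plane} {a b : Plane} (h : IsCcwSucc V a b) (hV : V' ⊆ V)
    (ha : a ∈ V') (hb : b ∈ V') : IsCcwSucc V' a b :=
  ⟨ha, hb, h.2.2.1, fun w hw => h.2.2.2 w (hV hw)⟩

namespace IsCyclicallyOrdered

variable {P V : Finset Plane}

theorem mono (hP : IsCyclicallyOrdered P) (hV : V ⊆ P) : IsCyclicallyOrdered V where
  total a ha b hb c hc := hP.total a (hV ha) b (hV hb) c (hV hc)
  trans a ha b hb c hc d hd := hP.trans a (hV ha) b (hV hb) c (hV hc) d (hV hd)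
  extreme a ha := inter_extremePoints_subset_extremePoints_of_subset
    (convexHull_mono (Finset.coe_subset.mpr hV))
    ⟨subset_convexHull ℝ _ (Finset.mem_coe.mpr ha), hP.extreme a (hV ha)⟩

theorem hullVertices_eq (hV : IsCyclicallyOrdered V) : hullVertices V = V := by
  ext x
  simp only [hullVertices, Finset.mem_filter]
  exact ⟨fun h => h.1, fun h => ⟨h, hV.extreme x h⟩⟩

/-- The successor of `a` is the least other point, in the linear order obtained by cutting the
cyclic order open at `a`. -/
theorem exists_isCcwSucc (hV : IsCyclicallyOrdered V) {a b : Plane} (ha : a ∈ V) (hb : b ∈ V)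
    (hab : b ≠ a) : ∃ c, IsCcwSucc V a c := by
  classical
  suffices h : ∀ T : Finset Plane, T ⊆ V.erase a → T.Nonempty →
      ∃ c ∈ T, ∀ w ∈ T, w ≠ c → 0 < cross (c - a) (w - a) by
    obtain ⟨c, hc, hmin⟩ := h _ subset_rfl ⟨b, Finset.mem_erase.mpr ⟨hab, hb⟩⟩
    rw [Finset.mem_erase] at hc
    exact ⟨c, ha, hc.2, hc.1.symm, fun w hw hwa => hmin w (Finset.mem_erase.mpr ⟨hwa, hw⟩)⟩
  intro T hT hne
  induction hne using Finset.Nonempty.cons_induction with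
  | singleton c => exact ⟨c, by simp, by simp⟩
  | cons x T hxT _ ih =>
    rw [Finset.cons_eq_insert] at hT ⊢
    obtain ⟨c, hc, hmin⟩ := ih ((Finset.subset_insert _ _).trans hT)
    have hT' : ∀ y ∈ insert x T, y ≠ a ∧ y ∈ V := fun y hy => Finset.mem_erase.mp (hT hy)
    have hx := hT' x (Finset.mem_insert_self _ _)
    have hc' := hT' c (Finset.mem_insert_of_mem hc)
    have hxc : x ≠ c := by rintro rfl; exact hxT hc
    rcases hV.total a ha x hx.2 c hc'.2 hx.1.symm hc'.1.symm hxc with h | h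
    · refine ⟨x, Finset.mem_insert_self _ _, fun w hw hwx => ?_⟩
      have hwT := (Finset.mem_insert.mp hw).resolve_left hwx
      by_cases hwc : w = c
      · rwa [hwc]
      · exact hV.trans a ha x hx.2 c hc'.2 w (hT' w hw).2 h (hmin w hwT hwc)
    · refine ⟨c, Finset.mem_insert_of_mem hc, fun w hw hwc => ?_⟩
      rcases Finset.mem_insert.mp hw with rfl | hwT
      · exact h
      · exact hmin w hwT hwc

theorem isCcwSucc_ccwSucc (hV : IsCyclicallyOrdered V) {a b : Plane} (ha : a ∈ V) (hb : b ∈ V)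
    (hab : b ≠ a) : IsCcwSucc V a (ccwSucc V a) := by
  have h := hV.exists_isCcwSucc ha hb hab
  rw [ccwSucc, dif_pos h]
  exact h.choose_spec

open Classical in
/-- A new point `x` to the right of the edge from `a` to its successor `b` goes in between them and
leaves all other successors alone. -/
theorem isCcwSucc_insert (hP : IsCyclicallyOrdered P) (hV : V ⊆ P) {a b x : Plane}
    (hab : IsCcwSucc V a b) (hx : x ∈ P) (hright : cross (b - a) (x - a) < 0) :
    IsCcwSucc (insert x V) a x ∧ IsCcwSucc (insert x V) x b ∧
      ∀ c d, c ≠ a → IsCcwSucc V c d → IsCcwSucc (insert x V) c d := by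
  obtain ⟨ha, hb, hne, hmin⟩ := hab
  have haP := hV ha
  have hbP := hV hb
  have haxb : 0 < cross (x - a) (b - a) := by rw [cross_swap]; linarith
  have hxa : x ≠ a := by rintro rfl; simp [cross] at haxb
  have hxb : x ≠ b := by rintro rfl; simp [cross_self] at haxb
  refine ⟨⟨by simp [ha], by simp, hxa.symm, ?_⟩, ⟨by simp, by simp [hb], hxb, ?_⟩, ?_⟩
  · intro w hw hwa hwx
    have hwV := (Finset.mem_insert.mp hw).resolve_left hwx
    by_cases hwb : w = b
    · rwa [hwb]
    · exact hP.trans a haP x hx b hbP w (hV hwV) haxb (hmin w hwV hwa hwb)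
  · intro w hw hwx hwb
    have hwV := (Finset.mem_insert.mp hw).resolve_left hwx
    rw [cross_sub_cyclic]
    by_cases hwa : w = a
    · rw [hwa, ← cross_sub_cyclic, ← cross_sub_cyclic]
      exact haxb
    · have h1 := hmin w hwV hwa hwb
      rw [cross_sub_cyclic] at h1
      have h2 := haxb
      rw [cross_sub_cyclic, cross_sub_cyclic] at h2
      exact hP.trans b hbP w (hV hwV) a haP x hx h1 h2
  · rintro c d hca ⟨hc, hd, hcd, hcmin⟩
    refine ⟨Finset.mem_insert_of_mem hc, Finset.mem_insert_of_mem hd, hcd, ?_⟩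
    intro w hw hwc hwd
    rcases Finset.mem_insert.mp hw with rfl | hwV
    swap
    · exact hcmin w hwV hwc hwd
    have hcP := hV hc
    -- in the linear order cut open at `c`, the new point comes after `a`
    have hcax : 0 < cross (a - c) (w - c) := by
      rw [cross_sub_cyclic]
      by_cases hcb : c = b
      · rwa [hcb]
      · exact hP.trans a haP w hx b hbP c hcP haxb (hmin c hc hca hcb)
    by_cases hda : d = a
    · rwa [hda]
    · exact hP.trans c hcP d (hV hd) a haP w hx
        (hcmin a ha hca.symm (Ne.symm hda)) hcax

end IsCyclicallyOrdered

section Vertices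

variable {n : ℕ} {v : Fin n → Plane}

open Classical in
/-- The vertices of the polygon as a finite set. -/
noncomputable def vertexFinset (v : Fin n → Plane) : Finset Plane := Finset.univ.image v

theorem mem_vertexFinset {x : Plane} : x ∈ vertexFinset v ↔ ∃ i, v i = x := by
  simp [vertexFinset]

theorem coe_vertexFinset (v : Fin n → Plane) : (vertexFinset v : Set Plane) = Set.range v := by
  ext x; simp [mem_vertexFinset]

theorem IsConvexPolygon.card_vertexFinset (hv : IsConvexPolygon v) :
    (vertexFinset v).card = n := by
  rw [vertexFinset, Finset.card_image_of_injective _ hv.injective, Finset.card_univ,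
    Fintype.card_fin]

theorem IsConvexPolygon.isCyclicallyOrdered (hv : IsConvexPolygon v) :
    IsCyclicallyOrdered (vertexFinset v) where
  total a ha b hb c hc hab hac hbc := by
    obtain ⟨i, rfl⟩ := mem_vertexFinset.mp ha
    obtain ⟨j, rfl⟩ := mem_vertexFinset.mp hb
    obtain ⟨k, rfl⟩ := mem_vertexFinset.mp hc
    rw [hv.ccw_iff, hv.ccw_iff]
    have hij : i ≠ j := fun h => hab (congrArg v h)
    have hik : i ≠ k := fun h => hac (congrArg v h)
    have hjk : j ≠ k := fun h => hbc (congrArg v h)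
    omega
  trans a ha b hb c hc d hd h₁ h₂ := by
    obtain ⟨i, rfl⟩ := mem_vertexFinset.mp ha
    obtain ⟨j, rfl⟩ := mem_vertexFinset.mp hb
    obtain ⟨k, rfl⟩ := mem_vertexFinset.mp hc
    obtain ⟨l, rfl⟩ := mem_vertexFinset.mp hd
    rw [hv.ccw_iff] at h₁ h₂ ⊢
    omega
  extreme a ha := by
    obtain ⟨i, rfl⟩ := mem_vertexFinset.mp ha
    rw [coe_vertexFinset]
    exact hv.vertex_mem_extremePoints i

theorem IsConvexPolygon.isCcwSucc_finRotate (hv : IsConvexPolygon v) (i : Fin n) :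
    IsCcwSucc (vertexFinset v) (v i) (v (finRotate n i)) := by
  refine ⟨mem_vertexFinset.mpr ⟨_, rfl⟩, mem_vertexFinset.mpr ⟨_, rfl⟩,
    fun h => hv.finRotate_ne i (hv.injective h).symm, ?_⟩
  intro w hw h1 h2
  obtain ⟨k, rfl⟩ := mem_vertexFinset.mp hw
  exact hv.edge_pos (fun h => h1 (congrArg v h)) (fun h => h2 (congrArg v h))

/-- The contact points of a probe along the line through two vertices `a` and `b`: the right
contact is `a` exactly when `ab` is an edge and lies strictly to the right of the line otherwise;
the left contact is `a` only if the whole polygon lies to the right, and it lies strictly to the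
left of the line otherwise. -/
theorem IsOutcome.contacts_of_through {ω : ℝ} (hω : ω ≤ Real.pi / 2) (hv : IsConvexPolygon v)
    (hangle : ∀ i, ω < internalAngle v i) {a b : Plane} (ha : a ∈ vertexFinset v)
    (hb : b ∈ vertexFinset v) (hab : a ≠ b) {W₀ : Wedge} {o : Outcome}
    (ho : IsOutcome ω (polygon v) (DirectedLine.through a b hab) W₀ o) :
    (o.p₁ = a → IsCcwSucc (vertexFinset v) a b) ∧
    (o.p₁ ≠ a → cross (b - a) (o.p₁ - a) < 0) ∧
    (o.p₂ = a → IsCcwSucc (vertexFinset v) b a) ∧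
    (o.p₂ ≠ a → 0 < cross (b - a) (o.p₂ - a)) := by
  obtain ⟨hp₁, hp₂, -⟩ := ho.contact_vertices hω hv hangle
  rw [← coe_vertexFinset, Finset.mem_coe] at hp₁ hp₂
  obtain ⟨⟨⟨hW, hsub, -, -⟩, hqL, hray⟩, -, h₁, h₂⟩ := ho
  have hord := hv.isCyclicallyOrdered
  have hmem : ∀ x ∈ vertexFinset v, x ∈ polygon v := fun x hx =>
    subset_convexHull ℝ _ (by rw [← coe_vertexFinset]; exact hx)
  have hcr := hW.2.2.2
  have hqO := apex_notMem_polygon hω hv hangle hW hsub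
  obtain ⟨s, hs, hsq⟩ := exists_apex_behind (convex_convexHull ℝ _) (hmem a ha) (hmem b hb) hqO
    hqL hray
  set q := o.wedge.apex with hq
  -- the side of the line on which a point lies may be measured from the apex, which is on the line
  have hshift : ∀ x, cross (b - a) (x - a) = cross (b - a) (x - q) := by
    intro x
    have : x - q = (x - a) + s • (b - a) := by rw [← hsq]; abel
    rw [this, cross_add_right, cross_smul_right, cross_self, mul_zero, add_zero]
  have hreg : ∀ x ∈ polygon v, 0 ≤ cross o.wedge.dir₁ (x - q) ∧ 0 ≤ cross (x - q) o.wedge.dir₂ :=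
    fun x hx => (mem_cone_iff hcr).mp (hsub hx)
  have hline : ∀ x ∈ vertexFinset v, x ≠ a → x ≠ b → cross (b - a) (x - a) ≠ 0 := by
    intro x hx hxa hxb h
    rcases hord.total a ha b hb x hx hab hxa.symm hxb.symm with h' | h'
    · linarith
    · rw [cross_swap] at h'; linarith
  have hn₁ : o.p₁ ≠ b := h₁.ne_far_point hab (hmem a ha) hs hsq
  have hn₂ : o.p₂ ≠ b := h₂.ne_far_point hab (hmem a ha) hs hsq
  obtain ⟨t₁, ht₁, hpt₁⟩ := h₁.1.2
  obtain ⟨t₂, ht₂, hpt₂⟩ := h₂.1.2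
  have hpq₁ : o.p₁ - q = t₁ • o.wedge.dir₁ := by rw [hpt₁, add_sub_cancel_left]
  have hpq₂ : o.p₂ - q = t₂ • o.wedge.dir₂ := by rw [hpt₂, add_sub_cancel_left]
  have hareg := hreg a (hmem a ha)
  rw [hsq, cross_smul_right, cross_smul_left] at hareg
  refine ⟨fun h => ⟨ha, hb, hab, fun w hw hwa hwb => ?_⟩, fun h => ?_,
    fun h => ⟨hb, ha, hab.symm, fun w hw hwb hwa => ?_⟩, fun h => ?_⟩
  · refine lt_of_le_of_ne ?_ (hline w hw hwa hwb).symm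
    rw [h, hsq] at hpq₁
    have h3 : s * cross (b - a) (w - q) = t₁ * cross o.wedge.dir₁ (w - q) := by
      rw [← cross_smul_left, ← cross_smul_left, hpq₁]
    have h4 := mul_nonneg ht₁ (hreg w (hmem w hw)).1
    rw [← h3] at h4
    rw [hshift]
    exact nonneg_of_mul_nonneg_right h4 hs
  · refine lt_of_le_of_ne ?_ (hline _ hp₁ h hn₁)
    rw [hshift, hpq₁, cross_smul_right, cross_swap]
    have := nonneg_of_mul_nonneg_right hareg.1 hs
    nlinarith [mul_nonneg ht₁ this]
  · rw [cross_sub_reverse]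
    refine neg_pos.mpr (lt_of_le_of_ne ?_ (hline w hw hwa hwb))
    rw [h, hsq] at hpq₂
    have h3 : s * cross (w - q) (b - a) = t₂ * cross (w - q) o.wedge.dir₂ := by
      rw [← cross_smul_right, ← cross_smul_right, hpq₂]
    have h4 := mul_nonneg ht₂ (hreg w (hmem w hw)).2
    rw [← h3] at h4
    rw [hshift, cross_swap]
    linarith [nonneg_of_mul_nonneg_right h4 hs]
  · refine lt_of_le_of_ne ?_ (hline _ hp₂ h hn₂).symm
    rw [hshift, hpq₂, cross_smul_right]
    exact mul_nonneg ht₂ (nonneg_of_mul_nonneg_right hareg.2 hs)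

end Vertices

/-! ### The invariant of the algorithm -/

open Classical in
/-- The part of the invariant that concerns `Q`: its vertices are vertices of the unknown polygon,
whose vertex set is `P`, successors are the true ones within `Q`, a true flag at `a` means that the
edge of `Q` starting at `a` is an edge of the unknown polygon, and `F` counts the false flags. -/
structure State.IsCoherent (P : Finset Plane) (S : State) : Prop where
  subset : S.verts ⊆ P
  succ : ∀ a ∈ S.verts, IsCcwSucc S.verts a (S.next a)
  flagged : ∀ a ∈ S.verts, S.flag a = true → IsCcwSucc P a (S.next a)
  F_eq : S.F = (S.verts.filter fun a => S.flag a = false).card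

namespace State.IsCoherent

variable {P : Finset Plane} {S : State}

open Classical in
/-- Confirming the edge that starts at `u`. -/
theorem flagEdge (h : S.IsCoherent P) {u : Plane} (hu : u ∈ S.verts) (hf : S.flag u = false)
    (he : IsCcwSucc P u (S.next u)) : ((S.setFlag u).addF (-1)).IsCoherent P where
  subset := h.subset
  succ := h.succ
  flagged := by
    intro a ha hfa
    by_cases hau : a = u
    · rw [hau]; exact he
    · refine h.flagged a ha ?_
      simpa [setFlag, addF, Function.update_of_ne hau] using hfa
  F_eq := by
    have hfil : (S.verts.filter fun a => (Function.update S.flag u true) a = false)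
        = (S.verts.filter fun a => S.flag a = false).erase u := by
      ext a
      by_cases hau : a = u
      · simp [hau]
      · simp [hau]
    change S.F + -1
      = ((S.verts.filter fun a => (Function.update S.flag u true) a = false).card : ℤ)
    rw [hfil, Finset.card_erase_of_mem (by simp [hu, hf]), h.F_eq]
    have : 0 < (S.verts.filter fun a => S.flag a = false).card :=
      Finset.card_pos.mpr ⟨u, by simp [hu, hf]⟩
    omega

open Classical in
theorem card_filter_update_insert {V : Finset Plane} {f : Plane → Bool} {x : Plane} (hx : x ∉ V) :
    ((insert x V).filter fun a => (Function.update f x false) a = false).card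
      = (V.filter fun a => f a = false).card + 1 := by
  rw [Finset.filter_insert, if_pos (Function.update_self _ _ _), Finset.card_insert_of_notMem
    (fun hmem => hx (Finset.mem_of_mem_filter _ hmem))]
  congr 2
  refine Finset.filter_congr fun a ha => ?_
  have hax : a ≠ x := by rintro rfl; exact hx ha
  rw [Function.update_of_ne hax]

open Classical in
/-- Inserting a vertex that lies to the right of an unconfirmed edge. -/
theorem insertBetween (hP : IsCyclicallyOrdered P) (h : S.IsCoherent P) {u x : Plane}
    (hu : u ∈ S.verts) (hf : S.flag u = false) (hx : x ∈ P) (hxV : x ∉ S.verts)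
    (hright : cross (S.next u - u) (x - u) < 0) :
    ((S.insertBetween u (S.next u) x).addF 1).IsCoherent P where
  subset := Finset.insert_subset hx h.subset
  succ := by
    obtain ⟨h₁, h₂, h₃⟩ := hP.isCcwSucc_insert h.subset (h.succ u hu) hx hright
    intro a ha
    simp only [State.insertBetween, addF] at ha ⊢
    by_cases hax : a = x
    · rw [hax, Function.update_self]; exact h₂
    rw [Function.update_of_ne hax]
    by_cases hau : a = u
    · rw [hau, Function.update_self]; exact h₁
    rw [Function.update_of_ne hau]
    exact h₃ a _ hau (h.succ a ((Finset.mem_insert.mp ha).resolve_left hax))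
  flagged := by
    intro a ha hfa
    simp only [State.insertBetween, addF] at ha hfa ⊢
    have hax : a ≠ x := by rintro rfl; simp at hfa
    rw [Function.update_of_ne hax] at hfa ⊢
    have hau : a ≠ u := by rintro rfl; simp [hf] at hfa
    rw [Function.update_of_ne hau]
    exact h.flagged a ((Finset.mem_insert.mp ha).resolve_left hax) hfa
  F_eq := by
    change S.F + 1
      = (((insert x S.verts).filter fun a => (Function.update S.flag x false) a = false).card : ℤ)
    rw [card_filter_update_insert hxV, h.F_eq]
    push_cast; rfl

open Classical in
theorem verts_addIfNew (hP : IsCyclicallyOrdered P) (h : S.IsCoherent P) {x : Plane}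
    (hx : x ∈ P) : (S.addIfNew x).verts = insert x S.verts := by
  unfold addIfNew
  split_ifs with hxV
  · rw [Finset.insert_eq_of_mem hxV]
  · exact (hP.mono (Finset.insert_subset hx h.subset)).hullVertices_eq

/-- Adding a vertex by forming the convex hull keeps all vertices. The confirmed edges survive,
because an edge of the unknown polygon is an edge of every subpolygon that has its endpoints. -/
theorem addIfNew (hP : IsCyclicallyOrdered P) (h : S.IsCoherent P) (hne : S.verts.Nonempty)
    {x : Plane} (hx : x ∈ P) : (S.addIfNew x).IsCoherent P := by
  classical
  have hverts := h.verts_addIfNew hP hx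
  by_cases hxV : x ∈ S.verts
  · rwa [State.addIfNew, if_pos hxV]
  have hVP := Finset.insert_subset hx h.subset
  have hV := hP.mono hVP
  rw [State.addIfNew, if_neg hxV] at hverts ⊢
  have hhull : hullVertices (insert x S.verts) = insert x S.verts := hV.hullVertices_eq
  have hsucc : ∀ a ∈ insert x S.verts,
      IsCcwSucc (insert x S.verts) a (ccwSucc (insert x S.verts) a) := by
    intro a ha
    by_cases hax : a = x
    · obtain ⟨b, hb⟩ := hne
      exact hV.isCcwSucc_ccwSucc ha (Finset.mem_insert_of_mem hb)
        (by rintro rfl; exact hxV (hax ▸ hb))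
    · exact hV.isCcwSucc_ccwSucc ha (Finset.mem_insert_self x _) (Ne.symm hax)
  refine ⟨?_, ?_, ?_, ?_⟩
  · rw [hverts]; exact hVP
  · intro a ha
    rw [hverts] at ha ⊢
    simp only [insertHull, addF, hhull]
    exact hsucc a ha
  · intro a ha hfa
    rw [hverts] at ha
    simp only [insertHull, addF, hhull] at hfa ⊢
    have hax : a ≠ x := by rintro rfl; simp at hfa
    rw [Function.update_of_ne hax] at hfa
    have haV := (Finset.mem_insert.mp ha).resolve_left hax
    have hedge := h.flagged a haV hfa
    have heq := (hsucc a ha).unique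
      (hedge.mono hVP ha (Finset.mem_insert_of_mem (h.succ a haV).2.1))
    rwa [heq]
  · rw [hverts]
    change S.F + 1
      = (((insert x S.verts).filter fun a => (Function.update S.flag x false) a = false).card : ℤ)
    rw [card_filter_update_insert hxV, h.F_eq]
    push_cast; rfl

/-- Adding a vertex leaves the number `card - F` of confirmed edges unchanged. -/
theorem F_addIfNew (hP : IsCyclicallyOrdered P) (h : S.IsCoherent P) {x : Plane} (hx : x ∈ P) :
    (S.addIfNew x).F - (S.addIfNew x).verts.card = S.F - S.verts.card := by
  classical
  rw [h.verts_addIfNew hP hx]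
  by_cases hxV : x ∈ S.verts
  · rw [State.addIfNew, if_pos hxV, Finset.insert_eq_of_mem hxV]
  · rw [State.addIfNew, if_neg hxV, Finset.card_insert_of_notMem hxV]
    simp only [insertHull, addF]
    push_cast; ring

theorem next_ne (h : S.IsCoherent P) {u : Plane} (hu : u ∈ S.verts) : u ≠ S.next u :=
  (h.succ u hu).2.2.1

/-- If nothing of `P` lies to the left of an edge of `Q`, then that edge is all of `Q`. -/
theorem verts_eq_pair (h : S.IsCoherent P) {u : Plane} (hu : u ∈ S.verts)
    (hback : IsCcwSucc P (S.next u) u) : S.next (S.next u) = u ∧ S.verts.card = 2 := by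
  classical
  have hs := h.succ u hu
  have hverts : S.verts = {u, S.next u} := by
    ext w
    simp only [Finset.mem_insert, Finset.mem_singleton]
    refine ⟨fun hw => ?_, ?_⟩
    · by_contra! hne
      have h₁ := hs.2.2.2 w hw hne.1 hne.2
      have h₂ := hback.2.2.2 w (h.subset hw) hne.2 hne.1
      rw [cross_sub_reverse] at h₂
      linarith
    · rintro (rfl | rfl)
      · exact hu
      · exact hs.2.1
  refine ⟨(h.succ _ hs.2.1).unique (hback.mono h.subset hs.2.1 hu), ?_⟩
  rw [hverts, Finset.card_pair hs.2.2.1]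

end State.IsCoherent

/-- The invariant after `k` probes. In the second alternative `card` is the number of vertices
found and `card - F` the number of edges confirmed: apart from the first two vertices, every probe
finds a vertex or confirms an edge, and the first iteration of the loop achieves two of these at
once, which pays for the initial probe. -/
structure Invariant (P : Finset Plane) (k : ℕ) (S : State) : Prop where
  coherent : S.IsCoherent P
  count : (k = 1 ∧ S.verts.card = 2 ∧ ∀ a ∈ S.verts, S.flag a = false) ∨
    (3 ≤ S.verts.card ∧ (k : ℤ) + S.F + 2 ≤ 2 * S.verts.card)

theorem invariant_firstState {P : Finset Plane} {o : Outcome} (h₁ : o.p₁ ∈ P) (h₂ : o.p₂ ∈ P)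
    (hne : o.p₁ ≠ o.p₂) : Invariant P 1 (firstState o) := by
  classical
  have hcard : ({o.p₁, o.p₂} : Finset Plane).card = 2 := Finset.card_pair hne
  have hpair : ∀ a b : Plane, a ≠ b → IsCcwSucc {a, b} a b := by
    refine fun a b hab => ⟨by simp, by simp, hab, fun w hw h1 h2 => ?_⟩
    simp only [Finset.mem_insert, Finset.mem_singleton] at hw
    exact absurd hw (not_or.mpr ⟨h1, h2⟩)
  refine ⟨⟨?_, ?_, ?_, ?_⟩, Or.inl ⟨rfl, hcard, fun _ _ => rfl⟩⟩
  · intro a ha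
    simp only [firstState, Finset.mem_insert, Finset.mem_singleton] at ha
    rcases ha with rfl | rfl <;> assumption
  · intro a ha
    simp only [firstState, Finset.mem_insert, Finset.mem_singleton] at ha ⊢
    rcases ha with rfl | rfl
    · rw [if_pos rfl]; exact hpair _ _ hne
    · rw [if_neg hne.symm, Finset.pair_comm]; exact hpair _ _ hne.symm
  · intro a _ hfa
    simp [firstState] at hfa
  · simp [firstState, hcard]

/-- One iteration of the loop preserves the invariant. -/
theorem Invariant.update {P : Finset Plane} (hP : IsCyclicallyOrdered P) (hcard : 3 ≤ P.card)
    {k : ℕ} {S : State} (h : Invariant P k S) {u : Plane} (hu : u ∈ S.verts)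
    (hf : S.flag u = false) {o : Outcome} (h₁ : o.p₁ ∈ P) (h₂ : o.p₂ ∈ P)
    (hR : o.p₁ = u → IsCcwSucc P u (S.next u))
    (hR' : o.p₁ ≠ u → cross (S.next u - u) (o.p₁ - u) < 0)
    (hL : o.p₂ = u → IsCcwSucc P (S.next u) u)
    (hL' : o.p₂ ≠ u → 0 < cross (S.next u - u) (o.p₂ - u)) :
    Invariant P (k + 1) (S.update u o) := by
  classical
  obtain ⟨hc, hcount⟩ := h
  have hs := hc.succ u hu
  -- a contact strictly to the right of the edge is new
  have hnew₁ : o.p₁ ≠ u → o.p₁ ∉ S.verts := by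
    intro hne hmem
    have hlt := hR' hne
    have hneb : o.p₁ ≠ S.next u := by
      intro he; rw [he, cross_self] at hlt; exact lt_irrefl _ hlt
    linarith [hs.2.2.2 _ hmem hne hneb]
  -- a contact strictly to the left of the edge is new if `Q` has only two vertices
  have hnew₂ : S.verts.card = 2 → o.p₂ ≠ u → o.p₂ ∉ S.verts := by
    intro h2 hne hmem
    have hlt := hL' hne
    have hsub : ({u, S.next u} : Finset Plane) ⊆ S.verts := by
      intro w hw
      simp only [Finset.mem_insert, Finset.mem_singleton] at hw
      rcases hw with rfl | rfl
      · exact hu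
      · exact hs.2.1
    have heq := Finset.eq_of_subset_of_card_le hsub (by rw [h2, Finset.card_pair hs.2.2.1])
    rw [← heq] at hmem
    simp only [Finset.mem_insert, Finset.mem_singleton] at hmem
    rw [hmem.resolve_left hne, cross_self] at hlt
    exact lt_irrefl _ hlt
  unfold State.update
  dsimp only
  split_ifs with hp₁ hp₂
  · -- the edge is confirmed
    have hedge := hR hp₁
    have hp₂ : o.p₂ ≠ u := by
      -- otherwise the polygon lies on both sides of the line
      intro hp₂
      have hback := hL hp₂
      obtain ⟨w, hw, hwn⟩ := Finset.exists_mem_notMem_of_card_lt_card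
        (s := {u, S.next u}) (t := P) (by rw [Finset.card_pair hs.2.2.1]; omega)
      simp only [Finset.mem_insert, Finset.mem_singleton, not_or] at hwn
      have e₁ := hedge.2.2.2 w hw hwn.1 hwn.2
      have e₂ := hback.2.2.2 w hw hwn.2 hwn.1
      rw [cross_sub_reverse] at e₂
      linarith
    have hc' := hc.flagEdge hu hf hedge
    refine ⟨hc'.addIfNew hP ⟨u, hu⟩ h₂, Or.inr ?_⟩
    have hF := hc'.F_addIfNew hP h₂
    have hV := hc'.verts_addIfNew hP h₂
    have hle : S.verts.card ≤ (insert o.p₂ S.verts).card :=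
      Finset.card_le_card (Finset.subset_insert _ _)
    rw [hV] at hF ⊢
    simp only [State.setFlag, State.addF] at hF hle ⊢
    rcases hcount with ⟨hk, h2, hall⟩ | ⟨h3, hk⟩
    · have hcard' := Finset.card_insert_of_notMem (hnew₂ h2 hp₂)
      have hF2 : S.F = 2 := by
        rw [hc.F_eq, Finset.filter_true_of_mem hall, h2]; rfl
      omega
    · omega
  · -- only two vertices are known, and the reversed edge is confirmed
    obtain ⟨hnext, h2⟩ := hc.verts_eq_pair hu (hL hp₂)
    rcases hcount with ⟨hk, -, hall⟩ | ⟨h3, -⟩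
    swap
    · omega
    have hc' := hc.flagEdge hs.2.1 (hall _ hs.2.1) (by rw [hnext]; exact hL hp₂)
    have hfu : ((S.setFlag (S.next u)).addF (-1)).flag u = false := by
      simp only [State.setFlag, State.addF]
      rw [Function.update_of_ne hs.2.2.1]; exact hf
    have hc'' := hc'.insertBetween hP hu hfu h₁ (hnew₁ hp₁) (hR' hp₁)
    have heq : (((S.setFlag (S.next u)).addF (-1)).insertBetween u (S.next u) o.p₁).addF 1
        = (S.setFlag (S.next u)).insertBetween u (S.next u) o.p₁ := by
      simp [State.insertBetween, State.addF]
    refine ⟨heq ▸ hc'', Or.inr ?_⟩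
    have hF2 : S.F = 2 := by
      rw [hc.F_eq, Finset.filter_true_of_mem hall, h2]; rfl
    have hcard' := Finset.card_insert_of_notMem (hnew₁ hp₁)
    simp only [State.insertBetween, State.setFlag]
    omega
  · -- a new vertex on the right, and possibly one on the left
    have hc' := hc.insertBetween hP hu hf h₁ (hnew₁ hp₁) (hR' hp₁)
    refine ⟨hc'.addIfNew hP ⟨u, Finset.mem_insert_of_mem hu⟩ h₂, Or.inr ?_⟩
    have hF := hc'.F_addIfNew hP h₂
    have hV := hc'.verts_addIfNew hP h₂
    rw [hV] at hF ⊢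
    simp only [State.insertBetween, State.addF] at hF hV ⊢
    have hcard₁ := Finset.card_insert_of_notMem (hnew₁ hp₁)
    have hle : (insert o.p₁ S.verts).card ≤ (insert o.p₂ (insert o.p₁ S.verts)).card :=
      Finset.card_le_card (Finset.subset_insert _ _)
    rcases hcount with ⟨hk, h2, hall⟩ | ⟨h3, hk⟩
    · have hne : o.p₂ ≠ o.p₁ := by
        intro he
        have := hL' hp₂
        rw [he] at this
        linarith [hR' hp₁]
      have hcard₂ := Finset.card_insert_of_notMem (s := insert o.p₁ S.verts) (a := o.p₂)
        (by simp only [Finset.mem_insert, not_or]; exact ⟨hne, hnew₂ h2 hp₂⟩)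
      have hF2 : S.F = 2 := by
        rw [hc.F_eq, Finset.filter_true_of_mem hall, h2]; rfl
      omega
    · omega

theorem Run.invariant {ω : ℝ} (hω : ω ≤ Real.pi / 2) {n : ℕ} {v : Fin n → Plane}
    (hv : IsConvexPolygon v) (hangle : ∀ i, ω < internalAngle v i) {p : Plane} {Ψ : Set Plane}
    {k : ℕ} {S : State} (h : Run ω (polygon v) p Ψ k S) : Invariant (vertexFinset v) k S := by
  induction h with
  | first L _ W₀ _ o ho =>
    obtain ⟨h₁, h₂, hne⟩ := ho.contact_vertices hω hv hangle
    rw [← coe_vertexFinset] at h₁ h₂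
    exact invariant_firstState h₁ h₂ hne
  | iterate _ _ u hu hflag hne W₀ _ o ho ih =>
    obtain ⟨h₁, h₂, -⟩ := ho.contact_vertices hω hv hangle
    rw [← coe_vertexFinset] at h₁ h₂
    obtain ⟨e₁, e₂, e₃, e₄⟩ := ho.contacts_of_through hω hv hangle (ih.coherent.subset hu)
      (ih.coherent.subset (ih.coherent.succ u hu).2.1) hne
    exact ih.update hv.isCyclicallyOrdered (by rw [hv.card_vertexFinset]; exact hv.1) hu hflag
      h₁ h₂ e₁ e₂ e₃ e₄

/-- If every edge of `Q` is an edge of the unknown polygon, going round `Q` reaches all vertices. -/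
theorem State.IsCoherent.verts_eq {n : ℕ} {v : Fin n → Plane} (hv : IsConvexPolygon v) {S : State}
    (h : S.IsCoherent (vertexFinset v)) (hne : S.verts.Nonempty)
    (hall : ∀ a ∈ S.verts, S.flag a = true) :
    (∀ i, v i ∈ S.verts) ∧ ∀ i, S.next (v i) = v (finRotate n i) := by
  have hstep : ∀ i, v i ∈ S.verts → S.next (v i) = v (finRotate n i) := fun i hi =>
    (h.flagged _ hi (hall _ hi)).unique (hv.isCcwSucc_finRotate i)
  obtain ⟨a, ha⟩ := hne
  obtain ⟨i₀, rfl⟩ := mem_vertexFinset.mp (h.subset ha)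
  have hmem : ∀ m : ℕ, v ((finRotate n)^[m] i₀) ∈ S.verts := by
    intro m
    induction m with
    | zero => exact ha
    | succ m ih =>
      rw [Function.iterate_succ_apply', ← hstep _ ih]
      exact (h.succ _ ih).2.1
  have hmem' : ∀ i, v i ∈ S.verts := by
    intro i
    obtain ⟨m, rfl⟩ : ∃ m, n = m + 1 := ⟨n - 1, by have := hv.1; omega⟩
    have hiter : ∀ l : ℕ, (finRotate (m + 1))^[l] i₀ = i₀ + Fin.ofNat (m + 1) l := by
      intro l
      induction l with
      | zero => simp
      | succ l ih =>
        rw [Function.iterate_succ_apply', ih, finRotate_apply, add_assoc]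
        congr 1
        ext
        simp [Fin.val_add]
    have := hmem (i - i₀).val
    rw [hiter] at this
    simpa using this
  exact ⟨hmem', fun i => hstep i (hmem' i)⟩

end WedgeProbe

open WedgeProbe
theorem mainTheorem1 (ω : ℝ) (hω₀ : 0 < ω) (hω : ω ≤ Real.pi / 2)
    (n : ℕ) (v : Fin n → Plane) (hv : IsConvexPolygon v)
    (hangle : ∀ i, ω < internalAngle v i)
    (p : Plane) (hp : p ∈ polygon v)
    (c : Plane) (r : ℝ) (hΨ : polygon v ⊆ Metric.closedBall c r) :
    -- the first probe can be carried out along every directed line through `p`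
    (∀ L : DirectedLine, p ∈ L.points → CanProbe ω (polygon v) (Metric.closedBall c r) L) ∧
    ∀ (k : ℕ) (S : State), Run ω (polygon v) p (Metric.closedBall c r) k S →
      -- at most `2n - 2` probes have been made
      k ≤ 2 * n - 2 ∧
      -- as long as `F ≠ 0`, an iteration can be carried out, for every admissible choice of `u`
      (S.F ≠ 0 →
        (∃ u ∈ S.verts, S.flag u = false) ∧
        ∀ u ∈ S.verts, S.flag u = false → ∃ hne : u ≠ S.next u,
          CanProbe ω (polygon v) (Metric.closedBall c r)
            (DirectedLine.through u (S.next u) hne)) ∧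
      -- when the algorithm stops, `Q` is the unknown polygon
      (S.F = 0 →
        S.polygon = polygon v ∧
        (S.verts : Set Plane) = Set.range v ∧
        ∀ i : Fin n, S.next (v i) = v (finRotate n i)) := by
  classical
  refine ⟨fun L hL => canProbe_of_meets hω₀ hω hv hangle hΨ hL hp, fun k S hrun => ?_⟩
  obtain ⟨hc, hcount⟩ := hrun.invariant hω hv hangle
  have hle := Finset.card_le_card hc.subset
  rw [hv.card_vertexFinset] at hle
  have hn := hv.1
  have hFeq := hc.F_eq
  refine ⟨?_, fun hF => ⟨?_, fun u hu _ => ⟨hc.next_ne hu, ?_⟩⟩, fun hF => ?_⟩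
  · rcases hcount with ⟨hk, -, -⟩ | ⟨-, hk⟩ <;> omega
  · by_contra! hall
    rw [Finset.filter_false_of_mem hall] at hFeq
    exact hF (by simpa using hFeq)
  · obtain ⟨i, rfl⟩ := mem_vertexFinset.mp (hc.subset hu)
    exact canProbe_of_meets hω₀ hω hv hangle hΨ ⟨0, by simp [DirectedLine.through]⟩
      (vertex_mem_polygon v i)
  · have hall : ∀ a ∈ S.verts, S.flag a = true := by
      rw [hF] at hFeq
      have := Finset.card_eq_zero.mp (by exact_mod_cast hFeq.symm)
      intro a ha
      simpa using Finset.filter_eq_empty_iff.mp this ha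
    have hne : S.verts.Nonempty := Finset.card_pos.mp (by rcases hcount with h | h <;> omega)
    obtain ⟨hmem, hnext⟩ := hc.verts_eq hv hne hall
    have hverts : (S.verts : Set Plane) = Set.range v := by
      refine Set.Subset.antisymm ?_ ?_
      · rw [← coe_vertexFinset]; exact Finset.coe_subset.mpr hc.subset
      · rintro _ ⟨i, rfl⟩; exact hmem i
    exact ⟨by rw [State.polygon, polygon, hverts], hverts, hnext⟩
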